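/- Let $F|k$ be a field extension with $k$ algebraically closed in $F$, and let $\Psi$ be an infinite set with symmetric group $\mathfrak{S}_\Psi$. Assume that $\bigotimes_{k,\,i\in\Psi}F$, the coproduct in the category of commutative $k$-algebras of copies of $F$ indexed by $\Psi$ (i.e. the inductive limit of the tensor products over $k$ of finitely many copies of $F$), is an integral domain (this is automatic in characteristic $0$), and let $F_\Psi$ be its field of fractions, on which $\mathfrak{S}_\Psi$ acts by permuting the tensor factors. An absolutely irreducible $k$-variety is an integral separated $k$-scheme of finite type that remains irreducible after every extension of the base field; for such a variety $Y$ denote by $k(Y)$ its function field and by $F_\Psi(Y)$ the field of fractions of $F_\Psi\otimes_k k(Y)$. Let $Y$ be an absolutely irreducible $k$-variety, and let $\mathfrak{S}_\Psi$ act on the field $K:=F_\Psi(Y)$ by automorphisms over $k$ so that the action extends the $\mathfrak{S}_\Psi$-action on $F_\Psi$ and is smooth, i.e. for every $x\in K$ there is a finite subset $J\subset\Psi$ such that every $\sigma\in\mathfrak{S}_\Psi$ fixing all elements of $J$ fixes $x$. Then there is an absolutely irreducible $k$-variety $Y'$ such that 1. there are an isomorphism of $k$-algebras $j:k(Y')\xrightarrow{\sim}K^{\mathfrak{S}_\Psi}$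 and an isomorphism of $F_\Psi$-algebras $F_\Psi(Y')\xrightarrow{\sim}F_\Psi(Y)=K$ that restricts to $j$ on $k(Y')$ (so $F_\Psi(Y)=F_\Psi(Y')$); 2. for some finite field extension $k'|k$, the base changes $Y_{k'}$ and $Y'_{k'}$ are birational over $k'$. -/

import Mathlib

open CategoryTheory AlgebraicGeometry
open scoped TensorProduct

universe u v w

noncomputable section

namespace Isotrivial

section Coproduct

variable (k : Type u) (F : Type v) (Ψ : Type w) [Field k] [Field F] [Algebra k F]

/-- The relations that make each `a ↦ X (i, a)` a homomorphism of `k`-algebras. -/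
inductive CopRel : MvPolynomial (Ψ × F) k → Prop
  | add (i : Ψ) (a b : F) :
      CopRel (MvPolynomial.X (i, a + b) - (MvPolynomial.X (i, a) + MvPolynomial.X (i, b)))
  | mul (i : Ψ) (a b : F) :
      CopRel (MvPolynomial.X (i, a * b) - MvPolynomial.X (i, a) * MvPolynomial.X (i, b))
  | scalar (i : Ψ) (c : k) :
      CopRel (MvPolynomial.X (i, algebraMap k F c) - MvPolynomial.C c)

/-- The coproduct of commutative `k`-algebras `⨂_{k, i ∈ Ψ} F` (the inductive limit of the tensor
products of finitely many copies of `F`), by generators and relations. Its universal property is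
given by `Cop.lift`, `Cop.lift_ι` and `Cop.hom_ext` below. -/
def Cop : Type (max u v w) :=
  MvPolynomial (Ψ × F) k ⧸ Ideal.span {p | CopRel k F Ψ p}

instance : CommRing (Cop k F Ψ) :=
  inferInstanceAs (CommRing (MvPolynomial (Ψ × F) k ⧸ Ideal.span {p | CopRel k F Ψ p}))

instance : Algebra k (Cop k F Ψ) :=
  inferInstanceAs (Algebra k (MvPolynomial (Ψ × F) k ⧸ Ideal.span {p | CopRel k F Ψ p}))

variable {F Ψ}

/-- The quotient map that presents `⨂_{k, i ∈ Ψ} F`. -/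
def Cop.mk : MvPolynomial (Ψ × F) k →ₐ[k] Cop k F Ψ :=
  Ideal.Quotient.mkₐ k (Ideal.span {p | CopRel k F Ψ p})

theorem Cop.mk_eq_of_rel {p q : MvPolynomial (Ψ × F) k} (h : CopRel k F Ψ (p - q)) :
    Cop.mk k p = Cop.mk k q :=
  Ideal.Quotient.eq.mpr (Ideal.subset_span h)

/-- The embedding of `F` as the `i`-th tensor factor, `a ↦ a(i)`. -/
def Cop.ι (i : Ψ) : F →ₐ[k] Cop k F Ψ :=
  AlgHom.ofLinearMap
    { toFun := fun a => Cop.mk k (MvPolynomial.X (i, a))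
      map_add' := fun a b => by
        rw [← map_add]; exact Cop.mk_eq_of_rel k (.add i a b)
      map_smul' := fun c a => by
        rw [RingHom.id_apply, Algebra.smul_def, Cop.mk_eq_of_rel k (.mul i _ a), map_mul,
          Cop.mk_eq_of_rel k (.scalar i c), ← MvPolynomial.algebraMap_eq, AlgHom.commutes,
          Algebra.smul_def] }
    (by
      change Cop.mk k (MvPolynomial.X (i, 1)) = 1
      have := Cop.mk_eq_of_rel k (CopRel.scalar (k := k) (F := F) i 1)
      rwa [map_one, map_one, map_one] at this)
    (fun a b => by
      change Cop.mk k (MvPolynomial.X (i, a * b)) =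
        Cop.mk k (MvPolynomial.X (i, a)) * Cop.mk k (MvPolynomial.X (i, b))
      rw [← map_mul]; exact Cop.mk_eq_of_rel k (.mul i a b))

/-- The homomorphism out of the coproduct given by a family of homomorphisms. -/
def Cop.lift {A : Type*} [CommRing A] [Algebra k A] (f : Ψ → F →ₐ[k] A) : Cop k F Ψ →ₐ[k] A :=
  Ideal.Quotient.liftₐ _ (MvPolynomial.aeval fun p : Ψ × F => f p.1 p.2) (by
    intro a ha
    have hle : Ideal.span {p | CopRel k F Ψ p} ≤
        RingHom.ker (MvPolynomial.aeval (R := k) fun p : Ψ × F => f p.1 p.2) := by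
      rw [Ideal.span_le]
      rintro p (⟨i, a, b⟩ | ⟨i, a, b⟩ | ⟨i, c⟩) <;> simp [RingHom.mem_ker]
    exact hle ha)

@[simp]
theorem Cop.lift_ι {A : Type*} [CommRing A] [Algebra k A] (f : Ψ → F →ₐ[k] A) (i : Ψ) (a : F) :
    Cop.lift k f (Cop.ι k i a) = f i a := by
  change MvPolynomial.aeval (R := k) (fun p : Ψ × F => f p.1 p.2) (MvPolynomial.X (i, a)) = f i a
  simp

theorem Cop.hom_ext {A : Type*} [CommRing A] [Algebra k A] {f g : Cop k F Ψ →ₐ[k] A}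
    (h : ∀ i a, f (Cop.ι k i a) = g (Cop.ι k i a)) : f = g := by
  have h' : f.comp (Cop.mk k) = g.comp (Cop.mk k) :=
    MvPolynomial.algHom_ext fun p => h p.1 p.2
  refine AlgHom.ext fun x => ?_
  obtain ⟨p, rfl⟩ := Ideal.Quotient.mk_surjective x
  exact DFunLike.congr_fun h' p

variable (F)

/-- A permutation `σ` permutes the tensor factors: it takes `a(i)` to `a(σ i)`. -/
def Cop.perm : Equiv.Perm Ψ →* (Cop k F Ψ ≃ₐ[k] Cop k F Ψ) where
  toFun σ := AlgEquiv.ofAlgHom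
    (Cop.lift k fun i => Cop.ι k (σ i)) (Cop.lift k fun i => Cop.ι k (σ⁻¹ i))
    (Cop.hom_ext k fun i a => by simp) (Cop.hom_ext k fun i a => by simp)
  map_one' := by
    refine AlgEquiv.coe_toAlgHom_injective (Cop.hom_ext k fun i a => ?_)
    simp
  map_mul' σ τ := by
    refine AlgEquiv.coe_toAlgHom_injective (Cop.hom_ext k fun i a => ?_)
    simp

variable (Ψ)

/-- `F_Ψ`: the ring of fractions of `⨂_{k, i ∈ Ψ} F`, a field when the latter is a domain. -/
def FPow : Type (max u v w) := FractionRing (Cop k F Ψ)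

instance : CommRing (FPow k F Ψ) := inferInstanceAs (CommRing (FractionRing (Cop k F Ψ)))

instance : Algebra (Cop k F Ψ) (FPow k F Ψ) :=
  inferInstanceAs (Algebra (Cop k F Ψ) (FractionRing (Cop k F Ψ)))

instance : Algebra k (FPow k F Ψ) := inferInstanceAs (Algebra k (FractionRing (Cop k F Ψ)))

instance : IsScalarTower k (Cop k F Ψ) (FPow k F Ψ) :=
  inferInstanceAs (IsScalarTower k (Cop k F Ψ) (FractionRing (Cop k F Ψ)))

instance : IsFractionRing (Cop k F Ψ) (FPow k F Ψ) :=
  inferInstanceAs (IsFractionRing (Cop k F Ψ) (FractionRing (Cop k F Ψ)))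

theorem FPow.isField [IsDomain (Cop k F Ψ)] : IsField (FPow k F Ψ) :=
  Field.toIsField (FractionRing (Cop k F Ψ))

variable {Ψ}

/-- The action of the symmetric group of `Ψ` on `F_Ψ`. -/
def FPow.perm (σ : Equiv.Perm Ψ) : FPow k F Ψ ≃ₐ[k] FPow k F Ψ :=
  IsFractionRing.algEquivOfAlgEquiv (Cop.perm k F σ)

end Coproduct

section Varieties

variable (k : Type u) [Field k]

/-- An absolutely irreducible variety over `k`: an integral separated scheme of finite type over
`k` that stays irreducible after every extension of the base field. -/
structure AbsIrredVariety where
  /-- the underlying scheme -/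
  X : Scheme.{u}
  /-- the structure morphism -/
  str : X ⟶ Spec (.of k)
  integral : IsIntegral X
  separated : IsSeparated str
  locallyOfFiniteType : LocallyOfFiniteType str
  quasiCompact : QuasiCompact str
  geometricallyIrreducible : GeometricallyIrreducible str

attribute [instance] AbsIrredVariety.integral AbsIrredVariety.separated
  AbsIrredVariety.locallyOfFiniteType AbsIrredVariety.quasiCompact
  AbsIrredVariety.geometricallyIrreducible

variable {k}

/-- The function field `k(Y)`. -/
def AbsIrredVariety.FunField (Y : AbsIrredVariety k) : Type u := Y.X.functionField

instance (Y : AbsIrredVariety k) : Field Y.FunField :=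
  inferInstanceAs (Field Y.X.functionField)

/-- `k → Γ(Spec k) → Γ(Y) → k(Y)`. -/
instance (Y : AbsIrredVariety k) : Algebra k Y.FunField :=
  ((Scheme.ΓSpecIso (.of k)).inv ≫ Y.str.appTop ≫
    Y.X.presheaf.germ ⊤ (genericPoint Y.X) trivial).hom.toAlgebra

/-- The structure morphism of the base change `Y_{k'}`. -/
def AbsIrredVariety.baseChange (Y : AbsIrredVariety k) (k' : Type u) [Field k'] [Algebra k k'] :
    Limits.pullback Y.str (Spec.map (CommRingCat.ofHom (algebraMap k k'))) ⟶ Spec (.of k') :=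
  Limits.pullback.snd _ _

section FPowFun

variable (F : Type v) (Ψ : Type w) [Field F] [Algebra k F] (Y : AbsIrredVariety k)

/-- `F_Ψ(Y)`: the function field of `Y` over `F_Ψ`, that is, the ring of fractions
of `F_Ψ ⊗ k(Y)`, which is a domain when `Ψ` is infinite and
`⨂_{k, i ∈ Ψ} F` is a domain (for then `F_Ψ` is a regular extension of `k`). -/
def FPowFun : Type (max u v w) := FractionRing (FPow k F Ψ ⊗[k] Y.FunField)

instance : CommRing (FPowFun F Ψ Y) :=
  inferInstanceAs (CommRing (FractionRing (FPow k F Ψ ⊗[k] Y.FunField)))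

instance : Algebra (FPow k F Ψ ⊗[k] Y.FunField) (FPowFun F Ψ Y) :=
  inferInstanceAs (Algebra (FPow k F Ψ ⊗[k] Y.FunField)
    (FractionRing (FPow k F Ψ ⊗[k] Y.FunField)))

instance : IsFractionRing (FPow k F Ψ ⊗[k] Y.FunField) (FPowFun F Ψ Y) :=
  inferInstanceAs (IsFractionRing (FPow k F Ψ ⊗[k] Y.FunField)
    (FractionRing (FPow k F Ψ ⊗[k] Y.FunField)))

instance : Algebra (FPow k F Ψ) (FPowFun F Ψ Y) :=
  inferInstanceAs (Algebra (FPow k F Ψ) (FractionRing (FPow k F Ψ ⊗[k] Y.FunField)))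

instance : Algebra k (FPowFun F Ψ Y) :=
  inferInstanceAs (Algebra k (FractionRing (FPow k F Ψ ⊗[k] Y.FunField)))

instance : IsScalarTower (FPow k F Ψ) (FPow k F Ψ ⊗[k] Y.FunField) (FPowFun F Ψ Y) :=
  inferInstanceAs (IsScalarTower (FPow k F Ψ) (FPow k F Ψ ⊗[k] Y.FunField)
    (FractionRing (FPow k F Ψ ⊗[k] Y.FunField)))

instance : IsScalarTower k (FPow k F Ψ ⊗[k] Y.FunField) (FPowFun F Ψ Y) :=
  inferInstanceAs (IsScalarTower k (FPow k F Ψ ⊗[k] Y.FunField)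
    (FractionRing (FPow k F Ψ ⊗[k] Y.FunField)))

instance : IsScalarTower k (FPow k F Ψ) (FPowFun F Ψ Y) :=
  inferInstanceAs (IsScalarTower k (FPow k F Ψ) (FractionRing (FPow k F Ψ ⊗[k] Y.FunField)))

/-- The embedding of `k(Y)` into `F_Ψ(Y)`. -/
def FPowFun.ofFun : Y.FunField →ₐ[k] FPowFun F Ψ Y :=
  (IsScalarTower.toAlgHom k (FPow k F Ψ ⊗[k] Y.FunField) (FPowFun F Ψ Y)).comp
    Algebra.TensorProduct.includeRight

end FPowFun

end Varieties

section Actions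

variable {k : Type u} {Ψ : Type w} {K : Type v} [Field k] [CommRing K] [Algebra k K]

/-- Smoothness of an action of the symmetric group of `Ψ`: every stabilizer is open, that is,
contains the pointwise stabilizer of a finite subset of `Ψ`. -/
def IsSmooth (ρ : Equiv.Perm Ψ →* (K ≃ₐ[k] K)) : Prop :=
  ∀ x : K, ∃ J : Finset Ψ, ∀ σ : Equiv.Perm Ψ, (∀ i ∈ J, σ i = i) → ρ σ x = x

/-- The invariants of an action. -/
def invariants (ρ : Equiv.Perm Ψ →* (K ≃ₐ[k] K)) : Subalgebra k K where
  carrier := {x | ∀ σ, ρ σ x = x}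
  mul_mem' ha hb σ := by rw [map_mul, ha σ, hb σ]
  add_mem' ha hb σ := by rw [map_add, ha σ, hb σ]
  algebraMap_mem' c σ := AlgEquiv.commutes _ c

end Actions

end Isotrivial

end

noncomputable section

namespace Isotrivial

/-! ### Permutations of an infinite set -/

section Permutations

variable {Ψ : Type*}

/-! Write `L` for `F_Ψ`, `G` for the symmetric group of `Ψ`, and `K` for `F_Ψ(Y)`. Every element of
`L` has a finite support in `Ψ`, subfields with disjoint supports are linearly disjoint over `k`,
and, `Ψ` being infinite, a finite support can be moved off any finite set. `SupportSystem` records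
these facts, and nothing else about `L` is needed.

The engine is a determinant (`SupportSystem.exists_det_ne_zero`): for `l i` in `L` independent over
`k` and supported off `J` there are permutations `g j` fixing `J` with `det (g j (l i)) ≠ 0`.
Applying the `g j` to a relation `∑ l i * c i = 0` whose coefficients are fixed by the stabilizer of
`J` forces `c = 0`. With `J = ∅` this says that `L` and `K^G` are linearly disjoint over `k`;
applied to `p`-th powers it says that `L|k` is separable in the sense of MacLane. Moving an
algebraic element off the supports of its conjugates shows that `k` is algebraically closed in `L`,
so `L|k` is regular.

To see that `K = L(K^G)`, use smoothness: `K = L(T)` with `T` finite and fixed by the stabilizer of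
a finite `J`. Move `J` by `g` to a disjoint `J'`. An element `f` of `g(T)` is fixed by the
stabilizer of `J'`, and it is a quotient of combinations of a basis of `L_{J'}` with coefficients in
the field `fixedOff` of elements fixed by the stabilizer of some finite set disjoint from `J'`. A
denominator of minimal support, normalised to have a coefficient `1`, has coefficients fixed by the
stabilizer of `J'`. These are then fixed by the stabilizers of two disjoint finite sets, which
generate `G`; so `f` lies in `L(K^G)`.

Linear disjointness makes `K^G` finitely generated over `k`, and `Y'` is an affine model of it. It
is geometrically irreducible because `K^G ⊗ E` embeds in `K ⊗ E`, where `K` is the fraction field of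
`L ⊗ k(Y)` with `L|k` regular.

For the birationality, let `A`, `A'` be coordinate rings of affine models. `L ⊗ A` and `L ⊗ A'` have
the same fraction field, and comparing generators involves finitely many elements of `L`. So for
some finitely generated `B ⊆ L` the rings `B ⊗ A` and `B ⊗ A'` have a common localization; a closed
point of it has a residue field `k'` finite over `k`, and base change along `B → k'` gives the claim
(`exists_finite_common_localization`). -/

theorem exists_perm_eqOn {T : Set Ψ} (hT : T.Finite) {f : Ψ → Ψ} (hf : Set.InjOn f T) :
    ∃ g : Equiv.Perm Ψ, Set.EqOn g f T := by
  have := hT.to_subtype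
  obtain ⟨g, hg⟩ := Equiv.Perm.exists_extending_pair (fun x : T => (x : Ψ)) (fun x : T => f x)
    Subtype.val_injective (fun x y h => Subtype.ext (hf x.2 y.2 h))
  exact ⟨g, fun x hx => hg ⟨x, hx⟩⟩

variable [Infinite Ψ]

/-- A finite set can be moved off another one by a permutation that fixes a third finite set,
disjoint from the first one. -/
theorem exists_perm_disjoint_image {I J T : Set Ψ} (hI : I.Finite) (hJ : J.Finite) (hT : T.Finite)
    (hIJ : Disjoint I J) :
    ∃ g : Equiv.Perm Ψ, (∀ i ∈ J, g i = i) ∧ Disjoint (g '' I) T := by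
  classical
  have := hI.to_subtype
  have hinf : (J ∪ T)ᶜ.Infinite := (hJ.union hT).infinite_compl
  have := hinf.to_subtype
  let e : I ↪ ((J ∪ T)ᶜ : Set Ψ) :=
    ((Finite.equivFin I).toEmbedding.trans (Fin.valEmbedding)).trans (Infinite.natEmbedding _)
  let f : Ψ → Ψ := fun x => if h : x ∈ I then e ⟨x, h⟩ else x
  have hfI : ∀ x (h : x ∈ I), f x = e ⟨x, h⟩ := fun x h => dif_pos h
  have hfJ : ∀ x ∈ J, f x = x := fun x h => dif_neg fun h' => Set.disjoint_left.1 hIJ h' h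
  have hf : Set.InjOn f (I ∪ J) := by
    rintro x (hx | hx) y (hy | hy) h
    · rw [hfI x hx, hfI y hy] at h
      simpa using e.injective (Subtype.ext h)
    · rw [hfI x hx, hfJ y hy] at h
      exact absurd (Or.inl (h ▸ hy)) (e ⟨x, hx⟩).2
    · rw [hfI y hy, hfJ x hx] at h
      exact absurd (Or.inl (h ▸ hx)) (e ⟨y, hy⟩).2
    · rwa [hfJ x hx, hfJ y hy] at h
  obtain ⟨g, hg⟩ := exists_perm_eqOn (hI.union hJ) hf
  refine ⟨g, fun i hi => (hg (Or.inr hi)).trans (hfJ i hi), ?_⟩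
  rw [Set.disjoint_left]
  rintro _ ⟨x, hx, rfl⟩ hT'
  rw [hg (Or.inl hx), hfI x hx] at hT'
  exact (e ⟨x, hx⟩).2 (Or.inr hT')

/-- The pointwise stabilizers of two disjoint finite sets generate the symmetric group. -/
theorem forall_smul_eq_of_disjoint {K : Type*} [MulAction (Equiv.Perm Ψ) K] {x : K} {I J : Set Ψ}
    (hI : I.Finite) (hJ : J.Finite) (hIJ : Disjoint I J)
    (hxI : ∀ g : Equiv.Perm Ψ, (∀ i ∈ I, g i = i) → g • x = x)
    (hxJ : ∀ g : Equiv.Perm Ψ, (∀ i ∈ J, g i = i) → g • x = x) (g : Equiv.Perm Ψ) :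
    g • x = x := by
  classical
  -- As `h` fixes `J` it fixes `x`, so `x` is also fixed by the stabilizer of `h I`, which is now
  -- disjoint from `g J` as well as from `J`.
  obtain ⟨h, hhJ, hh⟩ := exists_perm_disjoint_image hI hJ (hJ.union (hJ.image g)) hIJ
  have hx : ∀ a : Equiv.Perm Ψ, (∀ i ∈ h '' I, a i = i) → a • x = x := by
    intro a ha
    have := hxI (h⁻¹ * a * h) fun i hi => by simp [ha (h i) ⟨i, hi, rfl⟩]
    rw [mul_smul, mul_smul, inv_smul_eq_iff, hxJ h hhJ] at this
    exact this
  -- Factor `g = a * (a⁻¹ * g)`: `a` is the identity on `h I` and agrees with `g` on `J`, so `a⁻¹ *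
  -- g` is the identity on `J`.
  obtain ⟨a, ha⟩ := exists_perm_eqOn (f := fun i => if i ∈ h '' I then i else g i)
    ((hI.image h).union hJ) (by
      have key : ∀ x ∈ h '' I, ∀ y ∈ J, y ∉ h '' I ∧ x ≠ g y := fun x hx y hy =>
        ⟨fun h' => Set.disjoint_left.1 hh h' (Or.inl hy), fun h' =>
          Set.disjoint_left.1 hh hx (Or.inr ⟨y, hy, h'.symm⟩)⟩
      rintro x (hx | hx) y (hy | hy) hxy
      · simpa only [if_pos hx, if_pos hy] using hxy
      · simp only [if_pos hx, if_neg (key x hx y hy).1] at hxy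
        exact absurd hxy (key x hx y hy).2
      · simp only [if_pos hy, if_neg (key y hy x hx).1] at hxy
        exact absurd hxy.symm (key y hy x hx).2
      · have h1 : ∀ z ∈ J, z ∉ h '' I := fun z hz h' => Set.disjoint_left.1 hh h' (Or.inl hz)
        simp only [if_neg (h1 x hx), if_neg (h1 y hy)] at hxy
        exact g.injective hxy)
  have h1 : a • x = x := hx a fun i hi => by rw [ha (Or.inl hi)]; exact if_pos hi
  have h2 : (a⁻¹ * g) • x = x := hxJ _ fun i hi => by
    have : a i = g i := by
      rw [ha (Or.inr hi)]
      exact if_neg fun h' => Set.disjoint_left.1 hh h' (Or.inl hi)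
    rw [Equiv.Perm.mul_apply, ← this]
    simp
  rw [mul_smul, inv_smul_eq_iff, h1] at h2
  exact h2

end Permutations

/-! ### Fields with finite supports: the determinant argument and its consequences -/

section SupportSystem

variable {k L Ψ : Type*} [Field k] [Field L] [Algebra k L]

/-- An action of the symmetric group of `Ψ` on a field extension `L` of `k` together with the
subfields `S I` of elements supported on `I`, such that disjoint supports mean linear
disjointness. -/
structure SupportSystem (ρ : Equiv.Perm Ψ →* (L ≃ₐ[k] L)) (S : Set Ψ → IntermediateField k L) :
    Prop where
  union : ∀ I J, S (I ∪ J) = S I ⊔ S J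
  exists_mem : ∀ x, ∃ I : Set Ψ, I.Finite ∧ x ∈ S I
  map_mem : ∀ (g : Equiv.Perm Ψ) I x, x ∈ S I → ρ g x ∈ S (g '' I)
  fixed : ∀ (g : Equiv.Perm Ψ) I x, (∀ i ∈ I, g i = i) → x ∈ S I → ρ g x = x
  disjoint : ∀ I J, Disjoint I J → (S I).LinearDisjoint (S J)

namespace SupportSystem

variable {ρ : Equiv.Perm Ψ →* (L ≃ₐ[k] L)} {S : Set Ψ → IntermediateField k L}
  (hS : SupportSystem ρ S)
include hS

theorem mono {I J : Set Ψ} (h : I ⊆ J) : S I ≤ S J := by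
  rw [← Set.union_eq_self_of_subset_left h, hS.union]
  exact le_sup_left

theorem exists_forall_mem {ι : Type*} [Finite ι] (l : ι → L) :
    ∃ I : Set Ψ, I.Finite ∧ ∀ i, l i ∈ S I := by
  choose I hI hl using fun i => hS.exists_mem (l i)
  exact ⟨⋃ i, I i, Set.finite_iUnion hI, fun i => hS.mono (Set.subset_iUnion I i) (hl i)⟩

theorem eq_zero_of_sum_eq_zero {I J : Set Ψ} (hIJ : Disjoint I J) {ι : Type*} [Fintype ι]
    {l c : ι → L} (hl : ∀ i, l i ∈ S I) (hc : ∀ i, c i ∈ S J) (hli : LinearIndependent k l)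
    (h : ∑ i, c i * l i = 0) (i : ι) : c i = 0 := by
  have h1 : LinearIndependent k (fun i => (⟨l i, hl i⟩ : S I)) :=
    LinearIndependent.of_comp (S I).val.toLinearMap hli
  have h2 := (hS.disjoint I J hIJ).linearIndependent_left h1
  have h3 := Fintype.linearIndependent_iff.1 h2 (fun i => ⟨c i, hc i⟩)
    (by simpa [IntermediateField.smul_def] using h) i
  exact congrArg Subtype.val h3

variable [Infinite Ψ]

/-- Add one row at a time, each moved off the supports of the others. In the expansion along the new
row the cofactors are supported away from its entries, so linear disjointness would make all of them
vanish; but one of them is the previous determinant. -/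
theorem exists_det_ne_zero {I J : Set Ψ} (hI : I.Finite) (hJ : J.Finite) (hIJ : Disjoint I J)
    {n : ℕ} {l : Fin n → L} (hl : ∀ i, l i ∈ S I) (hli : LinearIndependent k l) :
    ∃ g : Fin n → Equiv.Perm Ψ, (∀ j, ∀ i ∈ J, g j i = i) ∧
      (Matrix.of fun j i => ρ (g j) (l i)).det ≠ 0 := by
  induction n with
  | zero => exact ⟨Fin.elim0, fun j => j.elim0, by simp⟩
  | succ n ih =>
    obtain ⟨g, hgJ, hg⟩ := ih (l := fun i => l i.succ) (fun i => hl _)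
      (hli.comp _ (Fin.succ_injective n))
    obtain ⟨h, hhJ, hh⟩ := exists_perm_disjoint_image hI hJ
      (Set.finite_iUnion fun j => hI.image (g j)) hIJ
    refine ⟨Fin.cons h g, fun j => Fin.cases hhJ hgJ j, fun hdet => hg ?_⟩
    rw [Matrix.det_succ_row_zero] at hdet
    have hli' : LinearIndependent k (fun i => ρ h (l i)) :=
      hli.map' (ρ h).toLinearMap (LinearMap.ker_eq_bot_of_injective (ρ h).injective)
    -- The conclusion is used at index `0`: deleting column `0` leaves the matrix of the induction
    -- hypothesis.
    have := hS.eq_zero_of_sum_eq_zero hh (fun i => hS.map_mem h I _ (hl i)) (l := fun i => ρ h (l i))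
      (c := fun i : Fin (n + 1) => (-1) ^ (i : ℕ) *
        ((Matrix.of fun j i => ρ ((Fin.cons h g : Fin (n + 1) → Equiv.Perm Ψ) j) (l i)).submatrix
          Fin.succ i.succAbove).det) (fun i => ?_) hli' ?_ 0
    · simpa [Matrix.submatrix] using this
    · refine mul_mem (pow_mem (neg_mem (one_mem _)) _) ?_
      rw [Matrix.det_apply']
      refine sum_mem fun σ _ => mul_mem (intCast_mem _ _) (prod_mem fun j _ => ?_)
      exact hS.mono (Set.subset_iUnion _ (σ j)) (by
        simpa using hS.map_mem _ _ _ (hl _))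
    · rw [← hdet]
      refine Finset.sum_congr rfl fun i _ => ?_
      simp
      ring

/-- Elements of `L` that are supported off `J` and linearly independent over `k` stay linearly
independent over the elements fixed by the pointwise stabilizer of `J`. -/
theorem eq_zero_of_sum_eq_zero_of_fixed {K : Type*} [Field K] [Algebra L K]
    [Algebra k K] {ρK : Equiv.Perm Ψ →* (K ≃ₐ[k] K)}
    (hρ : ∀ g x, ρK g (algebraMap L K x) = algebraMap L K (ρ g x))
    {I J : Set Ψ} (hI : I.Finite) (hJ : J.Finite)
    (hIJ : Disjoint I J) {n : ℕ} {l : Fin n → L} {c : Fin n → K} (hl : ∀ i, l i ∈ S I)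
    (hc : ∀ i (g : Equiv.Perm Ψ), (∀ j ∈ J, g j = j) → ρK g (c i) = c i)
    (hli : LinearIndependent k l) (h : ∑ i, algebraMap L K (l i) * c i = 0) : c = 0 := by
  obtain ⟨g, hgJ, hg⟩ := hS.exists_det_ne_zero hI hJ hIJ hl hli
  -- Each `g j` fixes all `c i`, so its application to the relation gives row `j` of a linear system
  -- for `c` with nonzero determinant.
  refine Matrix.eq_zero_of_mulVec_eq_zero
    (M := (algebraMap L K).mapMatrix (Matrix.of fun j i => ρ (g j) (l i))) ?_ ?_
  · rw [← RingHom.map_det]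
    simpa using hg
  · ext j
    have := congrArg (ρK (g j)) h
    simpa [Matrix.mulVec, dotProduct, hρ, hc _ (g j) (hgJ j)] using this

/-- Applying the `g j` to a relation among the `p`-th powers gives a system whose matrix is the
Frobenius image of an invertible one. This is MacLane's criterion for separability. -/
theorem linearIndependent_pow (p : ℕ) [ExpChar k p] {n : ℕ} {l : Fin n → L}
    (hli : LinearIndependent k l) : LinearIndependent k (fun i => l i ^ p) := by
  have : ExpChar L p := expChar_of_injective_algebraMap (algebraMap k L).injective p
  obtain ⟨I, hI, hl⟩ := hS.exists_forall_mem l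
  obtain ⟨g, -, hg⟩ := hS.exists_det_ne_zero hI Set.finite_empty (Set.disjoint_empty I) hl hli
  rw [Fintype.linearIndependent_iff]
  intro c hc
  have h0 : (fun i => algebraMap k L (c i)) = 0 := by
    refine Matrix.eq_zero_of_mulVec_eq_zero
      (M := (frobenius L p).mapMatrix (Matrix.of fun j i => ρ (g j) (l i))) ?_ ?_
    · rw [← RingHom.map_det]
      exact (map_ne_zero _).2 hg
    · ext j
      have := congrArg (ρ (g j)) hc
      simpa [Matrix.mulVec, dotProduct, frobenius_def, Algebra.smul_def, mul_comm] using this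
  exact fun i => by simpa using congrFun h0 i

theorem linearIndependent_pow' (p : ℕ) [ExpChar k p] {ι : Type*} {l : ι → L}
    (hli : LinearIndependent k l) : LinearIndependent k (fun i => l i ^ p) := by
  rw [linearIndependent_iff_finset_linearIndependent] at hli ⊢
  intro s
  have := hS.linearIndependent_pow p ((hli s).comp _ s.equivFin.symm.injective)
  exact (linearIndependent_equiv s.equivFin.symm).1 this

/-- `k` is algebraically closed in `L`. -/
theorem mem_bot_of_isAlgebraic {x : L} (hx : IsAlgebraic k x) :
    x ∈ (⊥ : IntermediateField k L) := by
  have hne : minpoly k x ≠ 0 := minpoly.ne_zero hx.isIntegral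
  have hfin := Polynomial.rootSet_finite (minpoly k x) L
  have := hfin.to_subtype
  obtain ⟨T, hT, hroots⟩ := hS.exists_forall_mem
    (fun y : (minpoly k x).rootSet L => (y : L))
  obtain ⟨I, hI, hxI⟩ := hS.exists_mem x
  -- The set `T` supports every conjugate of `x` in `L`, in particular `ρ g x`, which is also
  -- supported on `g '' I`, disjoint from `T`. Hence it lies in `k`.
  obtain ⟨g, -, hg⟩ := exists_perm_disjoint_image hI Set.finite_empty hT (Set.disjoint_empty I)
  have h1 : ρ g x ∈ S T := hroots ⟨ρ g x, by
    rw [Polynomial.mem_rootSet]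
    exact ⟨hne, by rw [Polynomial.aeval_algHom_apply (ρ g), minpoly.aeval, map_zero]⟩⟩
  have h2 : ρ g x ∈ S (g '' I) ⊓ S T := ⟨hS.map_mem g I x hxI, h1⟩
  rw [(hS.disjoint _ _ hg).inf_eq_bot, IntermediateField.mem_bot] at h2
  obtain ⟨c, hc⟩ := h2
  exact IntermediateField.mem_bot.2 ⟨c, (ρ g).injective (by rw [AlgEquiv.commutes, hc])⟩

end SupportSystem

end SupportSystem

/-! ### Fixed fields of pointwise stabilizers -/

section FixedFields

variable {k K Ψ : Type*} [Field k] [Field K] [Algebra k K]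

/-- The subfield of elements fixed by the pointwise stabilizer of `J`. -/
def fixedBy (ρ : Equiv.Perm Ψ →* (K ≃ₐ[k] K)) (J : Set Ψ) : IntermediateField k K where
  carrier := {x | ∀ g : Equiv.Perm Ψ, (∀ i ∈ J, g i = i) → ρ g x = x}
  mul_mem' ha hb g hg := by rw [map_mul, ha g hg, hb g hg]
  add_mem' ha hb g hg := by rw [map_add, ha g hg, hb g hg]
  algebraMap_mem' c g _ := AlgEquiv.commutes _ c
  inv_mem' a ha g hg := by rw [map_inv₀, ha g hg]

variable {ρ : Equiv.Perm Ψ →* (K ≃ₐ[k] K)}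

theorem fixedBy_mono {I J : Set Ψ} (h : I ⊆ J) : fixedBy ρ I ≤ fixedBy ρ J :=
  fun _ hx g hg => hx g fun i hi => hg i (h hi)

theorem map_mem_fixedBy {J : Set Ψ} {x : K} (hx : x ∈ fixedBy ρ J) (g : Equiv.Perm Ψ) :
    ρ g x ∈ fixedBy ρ (g '' J) := by
  intro h hh
  have := hx (g⁻¹ * h * g) fun i hi => by simp [hh (g i) ⟨i, hi, rfl⟩]
  rw [map_mul, map_mul, AlgEquiv.mul_apply, AlgEquiv.mul_apply] at this
  have h2 := congrArg (ρ g) this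
  rwa [← AlgEquiv.mul_apply, ← map_mul, mul_inv_cancel, map_one, AlgEquiv.one_apply] at h2

theorem mem_fixedBy_empty {x : K} : x ∈ fixedBy ρ ∅ ↔ x ∈ invariants ρ :=
  ⟨fun h g => h g (by simp), fun h g _ => h g⟩

variable (ρ) in
/-- The subfield of elements that are fixed by the pointwise stabilizer of some finite set
disjoint from `J`. -/
def fixedOff (J : Set Ψ) : IntermediateField k K where
  carrier := {x | ∃ I : Set Ψ, I.Finite ∧ Disjoint I J ∧ x ∈ fixedBy ρ I}
  mul_mem' := by
    rintro a b ⟨I, hI, hIJ, ha⟩ ⟨I', hI', hIJ', hb⟩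
    exact ⟨I ∪ I', hI.union hI', hIJ.union_left hIJ', mul_mem
      (fixedBy_mono Set.subset_union_left ha) (fixedBy_mono Set.subset_union_right hb)⟩
  add_mem' := by
    rintro a b ⟨I, hI, hIJ, ha⟩ ⟨I', hI', hIJ', hb⟩
    exact ⟨I ∪ I', hI.union hI', hIJ.union_left hIJ', add_mem
      (fixedBy_mono Set.subset_union_left ha) (fixedBy_mono Set.subset_union_right hb)⟩
  algebraMap_mem' c := ⟨∅, Set.finite_empty, Set.empty_disjoint _, algebraMap_mem _ c⟩
  inv_mem' := by
    rintro a ⟨I, hI, hIJ, ha⟩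
    exact ⟨I, hI, hIJ, inv_mem ha⟩

theorem mem_fixedOff {J : Set Ψ} {x : K} :
    x ∈ fixedOff ρ J ↔ ∃ I : Set Ψ, I.Finite ∧ Disjoint I J ∧ x ∈ fixedBy ρ I := Iff.rfl

theorem map_mem_fixedOff {J : Set Ψ} {x : K} (hx : x ∈ fixedOff ρ J) {g : Equiv.Perm Ψ}
    (hg : ∀ i ∈ J, g i = i) : ρ g x ∈ fixedOff ρ J := by
  obtain ⟨I, hI, hIJ, h⟩ := hx
  refine ⟨g '' I, hI.image g, ?_, map_mem_fixedBy h g⟩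
  rw [Set.disjoint_left]
  rintro _ ⟨x, hx, rfl⟩ hJ
  have : g x = x := g.injective (hg _ hJ)
  exact Set.disjoint_left.1 hIJ hx (this ▸ hJ)

theorem mem_fixedBy_empty_of_mem_fixedOff [Infinite Ψ] {J : Set Ψ} (hJ : J.Finite) {x : K}
    (hx : x ∈ fixedOff ρ J) (hxJ : x ∈ fixedBy ρ J) : x ∈ fixedBy ρ ∅ := by
  obtain ⟨I, hI, hIJ, h⟩ := hx
  let : MulAction (Equiv.Perm Ψ) K := MulAction.compHom K ρ
  exact fun g _ => forall_smul_eq_of_disjoint hI hJ hIJ h hxJ g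

end FixedFields

/-! ### Linear disjointness of `L` from fixed fields -/

namespace SupportSystem

variable {k L K Ψ : Type*} [Field k] [Field L] [Field K] [Algebra k L] [Algebra k K] [Algebra L K]
  {ρ : Equiv.Perm Ψ →* (L ≃ₐ[k] L)} {S : Set Ψ → IntermediateField k L}
  {ρK : Equiv.Perm Ψ →* (K ≃ₐ[k] K)}
  (hS : SupportSystem ρ S) (hρ : ∀ g x, ρK g (algebraMap L K x) = algebraMap L K (ρ g x))
include hS hρ

theorem algebraMap_mem_fixedBy {J : Set Ψ} {x : L} (hx : x ∈ S J) :
    algebraMap L K x ∈ fixedBy ρK J := fun g hg => by rw [hρ, hS.fixed g J x hg hx]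

theorem linearIndependent_fixedOff [Infinite Ψ] {J : Set Ψ} (hJ : J.Finite) {ι : Type*} {l : ι → L}
    (hl : ∀ i, l i ∈ S J) (hli : LinearIndependent k l) :
    LinearIndependent (fixedOff ρK J) (fun i => algebraMap L K (l i)) := by
  rw [linearIndependent_iff']
  intro s c hc i hi
  choose I hI hIJ hcI using fun i => mem_fixedOff.1 (c i).2
  let e := s.equivFin
  have := hS.eq_zero_of_sum_eq_zero_of_fixed hρ hJ
    (Set.finite_iUnion fun j : Fin s.card => hI (e.symm j))
    (Set.disjoint_iUnion_right.2 fun j => (hIJ _).symm)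
    (l := fun j => l (e.symm j)) (c := fun j => c (e.symm j)) (fun j => hl _)
    (fun j => fixedBy_mono (Set.subset_iUnion (fun j : Fin s.card => I (e.symm j)) j) (hcI _))
    (hli.comp _ (Subtype.val_injective.comp e.symm.injective)) (by
      rw [← hc, e.symm.sum_comp (fun j : s => algebraMap L K (l j) * (c j : K)),
        Finset.sum_coe_sort s (fun j => algebraMap L K (l j) * (c j : K))]
      exact Finset.sum_congr rfl fun j _ => by rw [IntermediateField.smul_def, smul_eq_mul, mul_comm])
  have h2 := congrFun this (e ⟨i, hi⟩)
  simp only [Equiv.symm_apply_apply, Pi.zero_apply] at h2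
  exact Subtype.ext h2

theorem linearIndependent_fixedBy_empty [Infinite Ψ] {ι : Type*} {l : ι → L}
    (hli : LinearIndependent k l) :
    LinearIndependent (fixedBy ρK ∅) (fun i => algebraMap L K (l i)) := by
  rw [linearIndependent_iff']
  intro s c hc i hi
  let e := s.equivFin
  obtain ⟨I, hI, hl⟩ := hS.exists_forall_mem (fun j => l (e.symm j))
  have := hS.eq_zero_of_sum_eq_zero_of_fixed hρ hI Set.finite_empty (Set.disjoint_empty I)
    (l := fun j => l (e.symm j)) (c := fun j => c (e.symm j)) hl (fun j => (c _).2)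
    (hli.comp _ (Subtype.val_injective.comp e.symm.injective)) (by
      rw [← hc, e.symm.sum_comp (fun j : s => algebraMap L K (l j) * (c j : K)),
        Finset.sum_coe_sort s (fun j => algebraMap L K (l j) * (c j : K))]
      exact Finset.sum_congr rfl fun j _ => by rw [IntermediateField.smul_def, smul_eq_mul, mul_comm])
  have h2 := congrFun this (e ⟨i, hi⟩)
  simp only [Equiv.symm_apply_apply, Pi.zero_apply] at h2
  exact Subtype.ext h2

/-- The field `L` may be replaced by its part supported on `J`, since whatever is supported off `J`
already belongs to `fixedOff ρK J`. -/
theorem adjoin_fixedOff_eq_top [IsScalarTower k L K] {J : Set Ψ} {T : Set K}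
    (hT : T ⊆ fixedOff ρK J) (hgen : IntermediateField.adjoin L T = ⊤) :
    IntermediateField.adjoin (fixedOff ρK J) (algebraMap L K '' S J) = ⊤ := by
  rw [eq_top_iff]
  intro x _
  have hC : ∀ y ∈ fixedOff ρK J,
      y ∈ IntermediateField.adjoin (fixedOff ρK J) (algebraMap L K '' S J) := fun y hy =>
    algebraMap_mem (IntermediateField.adjoin (fixedOff ρK J) (algebraMap L K '' S J))
      (⟨y, hy⟩ : fixedOff ρK J)
  have hx : x ∈ IntermediateField.adjoin L T := hgen ▸ IntermediateField.mem_top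
  induction hx using IntermediateField.adjoin_induction with
  | mem y hy => exact hC y (hT hy)
  | algebraMap l =>
    obtain ⟨I, hI, hl⟩ := hS.exists_mem l
    have h1 : S (J ∪ I \ J) ≤ IntermediateField.comap (IsScalarTower.toAlgHom k L K)
        ((IntermediateField.adjoin (fixedOff ρK J) (algebraMap L K '' S J)).restrictScalars k) := by
      rw [hS.union, sup_le_iff]
      constructor
      · intro y hy
        exact IntermediateField.subset_adjoin _ _ ⟨y, hy, rfl⟩
      · intro y hy
        exact hC _ ⟨I \ J, hI.sdiff, Set.disjoint_sdiff_left, hS.algebraMap_mem_fixedBy hρ hy⟩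
    exact h1 (hS.mono (by simp) hl)
  | add x y _ _ hx hy => exact add_mem (hx trivial) (hy trivial)
  | inv x _ hx => exact inv_mem (hx trivial)
  | mul x y _ _ hx hy => exact mul_mem (hx trivial) (hy trivial)

end SupportSystem

/-! ### Descent of coefficients to the invariants -/

section

variable {k K Ψ : Type*} [Field k] [Field K] [Algebra k K] {ρ : Equiv.Perm Ψ →* (K ≃ₐ[k] K)}

/-- The action of the pointwise stabilizer of `J` on `fixedOff ρ J`. -/
def fixedOffMap {J : Set Ψ} {g : Equiv.Perm Ψ} (hg : ∀ i ∈ J, g i = i) (x : fixedOff ρ J) :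
    fixedOff ρ J := ⟨ρ g x, map_mem_fixedOff x.2 hg⟩

theorem fixedOffMap_zero {J : Set Ψ} {g : Equiv.Perm Ψ} (hg : ∀ i ∈ J, g i = i) :
    fixedOffMap (ρ := ρ) hg 0 = 0 := Subtype.ext (map_zero _)

theorem map_linearCombination_fixedOff {J : Set Ψ} {ι : Type*} {v : ι → K}
    (hv : ∀ i, v i ∈ fixedBy ρ J) {g : Equiv.Perm Ψ} (hg : ∀ i ∈ J, g i = i)
    (c : ι →₀ fixedOff ρ J) :
    ρ g (Finsupp.linearCombination (fixedOff ρ J) v c) =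
      Finsupp.linearCombination (fixedOff ρ J) v
        (c.mapRange (fixedOffMap hg) (fixedOffMap_zero hg)) := by
  rw [Finsupp.linearCombination_apply, Finsupp.linearCombination_apply, Finsupp.sum_mapRange_index
    (by simp), Finsupp.sum, Finsupp.sum, map_sum]
  refine Finset.sum_congr rfl fun i _ => ?_
  rw [IntermediateField.smul_def, IntermediateField.smul_def, smul_eq_mul, smul_eq_mul, map_mul,
    hv i g hg]
  rfl

/-- Quotients of combinations of the `v i` that are fixed by the pointwise stabilizer of `J`
are quotients of combinations with invariant coefficients. -/
theorem mem_of_linearCombination_mul_eq [Infinite Ψ] {J : Set Ψ} (hJ : J.Finite) {ι : Type*}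
    {v : ι → K} (hv : ∀ i, v i ∈ fixedBy ρ J) (hli : LinearIndependent (fixedOff ρ J) v)
    {N : Subfield K} (hN : ∀ i, v i ∈ N) (hN' : ∀ x ∈ fixedBy ρ ∅, x ∈ N) {f : K}
    (hf : f ∈ fixedBy ρ J) (c d : ι →₀ fixedOff ρ J) (hc : c ≠ 0)
    (h : Finsupp.linearCombination (fixedOff ρ J) v c * f =
      Finsupp.linearCombination (fixedOff ρ J) v d) : f ∈ N := by
  classical
  -- A minimal-denominator argument: either all coefficients are already fixed by the stabilizer of
  -- `J`, or a nonzero denominator of smaller support exists.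
  induction hn : c.support.card using Nat.strong_induction_on generalizing c d with
  | _ n ih =>
  subst hn
  obtain ⟨i₀, hi₀⟩ := Finsupp.ne_iff.1 hc
  rw [Finsupp.zero_apply] at hi₀
  -- Scaling makes the coefficient at `i₀` equal to `1`, which every permutation fixes.
  set a := (c i₀)⁻¹ with ha
  have ha0 : a ≠ 0 := inv_ne_zero hi₀
  have h1 : Finsupp.linearCombination (fixedOff ρ J) v (a • c) * f =
      Finsupp.linearCombination (fixedOff ρ J) v (a • d) := by
    rw [map_smul, map_smul, smul_mul_assoc, h]
  have hlin : Function.Injective (Finsupp.linearCombination (fixedOff ρ J) v) := hli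
  have hmap : ∀ g : Equiv.Perm Ψ, ∀ hg : ∀ i ∈ J, g i = i,
      Finsupp.linearCombination (fixedOff ρ J) v
        ((a • c).mapRange (fixedOffMap hg) (fixedOffMap_zero hg)) * f =
      Finsupp.linearCombination (fixedOff ρ J) v
        ((a • d).mapRange (fixedOffMap hg) (fixedOffMap_zero hg)) := by
    intro g hg
    rw [← map_linearCombination_fixedOff hv hg, ← map_linearCombination_fixedOff hv hg]
    conv_rhs => rw [← h1, map_mul, hf g hg]
  by_cases hfix : ∀ g : Equiv.Perm Ψ, ∀ hg : ∀ i ∈ J, g i = i,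
      (a • c).mapRange (fixedOffMap hg) (fixedOffMap_zero hg) = a • c
  · have hmem : ∀ e : ι →₀ fixedOff ρ J, (∀ g : Equiv.Perm Ψ, ∀ hg : ∀ i ∈ J, g i = i,
      e.mapRange (fixedOffMap hg) (fixedOffMap_zero hg) = e) → Finsupp.linearCombination (fixedOff ρ J) v e ∈ N := by
      intro e he
      rw [Finsupp.linearCombination_apply]
      refine sum_mem fun i _ => ?_
      change (e i : K) * v i ∈ N
      refine mul_mem (hN' _ (mem_fixedBy_empty_of_mem_fixedOff hJ (e i).2 fun g hg => ?_)) (hN i)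
      exact congrArg Subtype.val (DFunLike.congr_fun (he g hg) i)
    -- Once the denominator is fixed, so is the numerator, and independence of the `v i` passes this
    -- on to its coefficients.
    have hd : ∀ g : Equiv.Perm Ψ, ∀ hg : ∀ i ∈ J, g i = i,
      (a • d).mapRange (fixedOffMap hg) (fixedOffMap_zero hg) = a • d := by
      intro g hg
      apply hlin
      rw [← hmap g hg, hfix g hg, h1]
    have h0 : Finsupp.linearCombination (fixedOff ρ J) v (a • c) ≠ 0 := fun h0 => by
      have := hlin (h0.trans (map_zero _).symm)
      exact hc ((smul_eq_zero.1 this).resolve_left ha0)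
    rw [← mul_div_cancel_left₀ f h0, h1]
    exact div_mem (hmem _ hd) (hmem _ hfix)
  · push Not at hfix
    obtain ⟨g, hg, hne⟩ := hfix
    -- The difference of the translated and the original fraction has the same value `f`, and its
    -- denominator loses the coefficient at `i₀`.
    refine ih _ ?_ _ ((a • d).mapRange
      (fixedOffMap hg) (fixedOffMap_zero hg) - a • d)
      (sub_ne_zero.2 hne) (by rw [map_sub, map_sub, sub_mul, hmap g hg, h1]) rfl
    refine Finset.card_lt_card (Finset.ssubset_iff_of_subset ?_ |>.2 ⟨i₀, by simpa using hi₀, ?_⟩)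
    · intro i hi
      rw [Finsupp.mem_support_iff] at hi ⊢
      intro h0
      apply hi
      ext
      simp [h0, fixedOffMap_zero]
    · rw [Finsupp.notMem_support_iff]
      ext
      simp [ha, inv_mul_cancel₀ hi₀, fixedOffMap]

end

/-! ### Linear disjointness and finite generation -/

section

variable {k K M : Type*} [Field k] [Field K] [Field M] [Algebra k K] [Algebra k M] [Algebra M K]
  [IsScalarTower k M K]

theorem exists_linearCombination_eq_of_mem_adjoin {C : IntermediateField k K} {ι : Type*}
    (b : Module.Basis ι k M) {r : K} (hr : r ∈ Algebra.adjoin C (Set.range (algebraMap M K))) :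
    ∃ c, Finsupp.linearCombination C (fun i => algebraMap M K (b i)) c = r := by
  have hclosure : Submonoid.closure (Set.range (algebraMap M K)) = MonoidHom.mrange
      (algebraMap M K) := Submonoid.closure_eq (MonoidHom.mrange (algebraMap M K))
  rw [← Subalgebra.mem_toSubmodule, Algebra.adjoin_eq_span, hclosure] at hr
  rw [← LinearMap.mem_range, Finsupp.range_linearCombination]
  refine Submodule.span_le.2 ?_ hr
  rintro _ ⟨y, rfl⟩
  change algebraMap M K y ∈ _
  induction b.mem_span y using Submodule.span_induction with
  | mem y hy =>
    obtain ⟨i, rfl⟩ := hy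
    exact Submodule.subset_span ⟨i, rfl⟩
  | zero => simp
  | add y z _ _ hy hz =>
    rw [map_add]
    exact add_mem hy hz
  | smul a y _ hy =>
    rw [Algebra.smul_def, map_mul, ← IsScalarTower.algebraMap_apply]
    exact Submodule.smul_mem _ (algebraMap k C a) hy

/-- If an intermediate field is linearly disjoint from `M` and generates together with `M` a
finitely generated extension of `M`, then it is finitely generated. -/
theorem exists_finset_adjoin_eq_of_linearIndependent {C : IntermediateField k K} {ι : Type*}
    (b : Module.Basis ι k M) (hb : LinearIndependent C (fun i => algebraMap M K (b i)))
    (hC : IntermediateField.adjoin M (C : Set K) = ⊤) {T : Set K} (hT : T.Finite)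
    (hgen : IntermediateField.adjoin M T = ⊤) :
    ∃ T₀ : Finset K, IntermediateField.adjoin k (T₀ : Set K) = C := by
  classical
  have hex : ∀ t : K, ∃ U : Finset K, (U : Set K) ⊆ C ∧ t ∈ IntermediateField.adjoin M (U : Set K) :=
    fun t => IntermediateField.exists_finset_of_mem_adjoin (hC ▸ IntermediateField.mem_top)
  choose U hUC hU using hex
  let T₀ : Finset K := hT.toFinset.biUnion U
  have hT₀C : (T₀ : Set K) ⊆ C := by
    intro x hx
    obtain ⟨t, -, ht⟩ := Finset.mem_biUnion.1 hx
    exact hUC t ht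
  have htop : IntermediateField.adjoin M (T₀ : Set K) = ⊤ := by
    rw [eq_top_iff, ← hgen, IntermediateField.adjoin_le_iff]
    intro t ht
    refine IntermediateField.adjoin.mono M _ _ ?_ (hU t)
    exact_mod_cast Finset.subset_biUnion_of_mem U (hT.mem_toFinset.2 ht)
  have hle : IntermediateField.adjoin k (T₀ : Set K) ≤ C := IntermediateField.adjoin_le_iff.2 hT₀C
  refine ⟨T₀, le_antisymm hle fun x hx => ?_⟩
  set K₁ := IntermediateField.adjoin k (T₀ : Set K) with hK₁
  have hadj : ∀ r ∈ Algebra.adjoin M (T₀ : Set K),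
      ∃ c, Finsupp.linearCombination K₁ (fun i => algebraMap M K (b i)) c = r := by
    intro r hr
    apply exists_linearCombination_eq_of_mem_adjoin b
    induction hr using Algebra.adjoin_induction with
    | mem x hx =>
      exact algebraMap_mem (Algebra.adjoin K₁ (Set.range (algebraMap M K)))
        ⟨x, IntermediateField.subset_adjoin _ _ hx⟩
    | algebraMap l => exact Algebra.subset_adjoin ⟨l, rfl⟩
    | add x y _ _ hx hy => exact add_mem hx hy
    | mul x y _ _ hx hy => exact mul_mem hx hy
  have hxtop : x ∈ IntermediateField.adjoin M (T₀ : Set K) := htop ▸ IntermediateField.mem_top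
  obtain ⟨r, hr, s, hs, rfl⟩ := IntermediateField.mem_adjoin_iff_div.1 hxtop
  obtain ⟨d, hd⟩ := hadj r hr
  obtain ⟨c, hc⟩ := hadj s hs
  rcases eq_or_ne s 0 with rfl | hs0
  · simp
  have hc0 : c ≠ 0 := by
    rintro rfl
    exact hs0 (by simpa using hc.symm)
  obtain ⟨i, hi⟩ := Finsupp.ne_iff.1 hc0
  let inc : K₁ → C := IntermediateField.inclusion hle
  have hinc0 : inc 0 = 0 := map_zero (IntermediateField.inclusion hle)
  have hinc : ∀ e : ι →₀ K₁, Finsupp.linearCombination K₁ (fun i => algebraMap M K (b i)) e =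
      Finsupp.linearCombination C (fun i => algebraMap M K (b i)) (e.mapRange inc hinc0) := by
    intro e
    rw [Finsupp.linearCombination_apply, Finsupp.linearCombination_apply,
      Finsupp.sum_mapRange_index (by simp)]
    rfl
  -- Write `r` and `s` as combinations of the basis with coefficients in `K₁`. Independence over `C`
  -- allows coefficients to be compared in `x * s = r`, so `x` is a quotient of two elements of
  -- `K₁`.
  have heq : (⟨r / s, hx⟩ : C) • c.mapRange inc hinc0 = d.mapRange inc hinc0 := by
    apply hb
    rw [map_smul, ← hinc, ← hinc, hc, hd, IntermediateField.smul_def, smul_eq_mul,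
      div_mul_cancel₀ _ hs0]
  have hval : r / s * (c i : K) = d i :=
    congrArg Subtype.val (DFunLike.congr_fun heq i)
  have hci : (c i : K) ≠ 0 := fun h => hi (Subtype.ext h)
  rw [← mul_div_cancel_right₀ (r / s) hci, hval]
  exact div_mem (d i).2 (c i).2

theorem productMap_injective_of_linearIndependent {N : Type*} [CommRing N] [Algebra k N]
    (f : N →ₐ[k] K) {ι : Type*} (b : Module.Basis ι k N)
    (hb : LinearIndependent M (fun i => f (b i))) :
    Function.Injective (Algebra.TensorProduct.productMap (IsScalarTower.toAlgHom k M K) f) := by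
  classical
  rw [injective_iff_map_eq_zero]
  intro x hx
  obtain ⟨c, rfl⟩ := (TensorProduct.equivFinsuppOfBasisRight (M := M) b).symm.surjective x
  have h0 : Finsupp.linearCombination M (fun i => f (b i)) c = 0 := by
    rw [← hx, TensorProduct.equivFinsuppOfBasisRight_symm_apply, Finsupp.sum, map_sum,
      Finsupp.linearCombination_apply, Finsupp.sum]
    refine Finset.sum_congr rfl fun i _ => ?_
    simp [Algebra.smul_def]
  rw [hb (h0.trans (map_zero _).symm), map_zero]

end

/-! ### Generation of `K` by `L` and the invariants -/

namespace SupportSystem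

variable {k L K Ψ : Type*} [Field k] [Field L] [Field K] [Algebra k L] [Algebra k K] [Algebra L K]
  [IsScalarTower k L K]
  {ρ : Equiv.Perm Ψ →* (L ≃ₐ[k] L)} {S : Set Ψ → IntermediateField k L}
  {ρK : Equiv.Perm Ψ →* (K ≃ₐ[k] K)}
  (hS : SupportSystem ρ S) (hρ : ∀ g x, ρK g (algebraMap L K x) = algebraMap L K (ρ g x))
include hS hρ

theorem mem_adjoin_fixedBy_empty [Infinite Ψ] {J : Set Ψ} (hJ : J.Finite) {T : Set K}
    (hT : T ⊆ fixedOff ρK J) (hgen : IntermediateField.adjoin L T = ⊤) {f : K}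
    (hf : f ∈ fixedBy ρK J) : f ∈ IntermediateField.adjoin L (fixedBy ρK ∅ : Set K) := by
  let b := Module.Free.chooseBasis k (S J)
  let v := fun i => algebraMap L K (b i)
  have hv : ∀ i, v i ∈ fixedBy ρK J := fun i => hS.algebraMap_mem_fixedBy hρ (b i).2
  have hli : LinearIndependent (fixedOff ρK J) v :=
    hS.linearIndependent_fixedOff hρ hJ (fun i => (b i).2)
      (b.linearIndependent.map' (S J).val.toLinearMap
        (LinearMap.ker_eq_bot_of_injective Subtype.val_injective))
  have hrange : algebraMap L K '' S J = Set.range (algebraMap (S J) K) :=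
    Set.image_eq_range _ _
  have htop : f ∈ IntermediateField.adjoin (fixedOff ρK J) (algebraMap L K '' S J) :=
    hS.adjoin_fixedOff_eq_top hρ hT hgen ▸ IntermediateField.mem_top
  obtain ⟨r, hr, s, hs, rfl⟩ := IntermediateField.mem_adjoin_iff_div.1 htop
  rw [hrange] at hr hs
  obtain ⟨c, rfl⟩ := exists_linearCombination_eq_of_mem_adjoin b hs
  obtain ⟨d, rfl⟩ := exists_linearCombination_eq_of_mem_adjoin b hr
  rcases eq_or_ne c 0 with rfl | hc
  · simp
  refine mem_of_linearCombination_mul_eq hJ hv hli (N := (IntermediateField.adjoin L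
    (fixedBy ρK ∅ : Set K)).toSubfield) (fun i => algebraMap_mem (IntermediateField.adjoin L
    (fixedBy ρK ∅ : Set K)) (b i : L))
    (fun x hx => IntermediateField.subset_adjoin _ _ hx) hf c d hc (mul_div_cancel₀ _ fun h0 => hc ?_)
  exact hli (h0.trans (map_zero _).symm)

/-- `K` is generated by `L` and the invariants, if it is generated over `L` by elements fixed by
the pointwise stabilizer of a finite set. -/
theorem adjoin_fixedBy_empty_eq_top [Infinite Ψ] {J : Set Ψ} (hJ : J.Finite) {T : Set K}
    (hT : T ⊆ fixedBy ρK J) (hgen : IntermediateField.adjoin L T = ⊤) :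
    IntermediateField.adjoin L (fixedBy ρK ∅ : Set K) = ⊤ := by
  -- Generators in `T` are fixed by the stabilizer of `J`, hence lie in `fixedOff` for `g '' J`,
  -- while their images under `g` are fixed by the stabilizer of `g '' J`. So it is `ρK g` of
  -- everything that is shown to lie in the subfield; surjectivity of `ρK g` finishes.
  obtain ⟨g, -, hg⟩ := exists_perm_disjoint_image hJ Set.finite_empty hJ (Set.disjoint_empty J)
  have key : ∀ x : K, ρK g x ∈ IntermediateField.adjoin L (fixedBy ρK ∅ : Set K) := by
    intro x
    have hx : x ∈ IntermediateField.adjoin L T := hgen ▸ IntermediateField.mem_top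
    induction hx using IntermediateField.adjoin_induction with
    | mem y hy =>
      refine hS.mem_adjoin_fixedBy_empty hρ (hJ.image g) (T := T) (fun t ht => ?_) hgen
        (map_mem_fixedBy (hT hy) g)
      exact ⟨J, hJ, hg.symm, hT ht⟩
    | algebraMap l => rw [hρ]; exact algebraMap_mem _ _
    | add x y _ _ hx hy => rw [map_add]; exact add_mem hx hy
    | inv x _ hx => rw [map_inv₀]; exact inv_mem hx
    | mul x y _ _ hx hy => rw [map_mul]; exact mul_mem hx hy
  rw [eq_top_iff]
  intro x _
  have := key ((ρK g).symm x)
  rwa [AlgEquiv.apply_symm_apply] at this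

/-- `L` and the invariants are linearly disjoint over `k`. -/
theorem productMap_fixedBy_empty_injective [Infinite Ψ] :
    Function.Injective (Algebra.TensorProduct.productMap (IsScalarTower.toAlgHom k L K)
      (fixedBy ρK ∅).val) := by
  have h := IntermediateField.LinearDisjoint.of_basis_right' (A := fixedBy ρK ∅)
    (Module.Free.chooseBasis k L)
    (hS.linearIndependent_fixedBy_empty hρ (Module.Free.chooseBasis k L).linearIndependent)
  have h2 := IntermediateField.LinearDisjoint.linearIndependent_left h
    (Module.Free.chooseBasis k (fixedBy ρK ∅)).linearIndependent
  exact productMap_injective_of_linearIndependent _ (Module.Free.chooseBasis k (fixedBy ρK ∅)) h2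

/-- The invariants are finitely generated over `k`. -/
theorem exists_finset_adjoin_eq_fixedBy_empty [Infinite Ψ] {J : Set Ψ} (hJ : J.Finite) {T : Set K}
    (hTfin : T.Finite) (hT : T ⊆ fixedBy ρK J) (hgen : IntermediateField.adjoin L T = ⊤) :
    ∃ T₀ : Finset K, IntermediateField.adjoin k (T₀ : Set K) = fixedBy ρK ∅ :=
  exists_finset_adjoin_eq_of_linearIndependent (Module.Free.chooseBasis k L)
    (hS.linearIndependent_fixedBy_empty hρ (Module.Free.chooseBasis k L).linearIndependent)
    (hS.adjoin_fixedBy_empty_eq_top hρ hJ hT hgen) hTfin hgen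

end SupportSystem

/-- A left inverse of the combination map of `l` provides functionals dual to `l`; contract the
first factor with them. -/
theorem eq_zero_of_sum_tmul_eq_zero {k M N : Type*} [Field k] [AddCommGroup M] [Module k M]
    [AddCommGroup N] [Module k N] {ι : Type*} {l : ι → M} (hl : LinearIndependent k l)
    {s : Finset ι} {c : ι → N} (h : ∑ i ∈ s, l i ⊗ₜ[k] c i = 0) : ∀ i ∈ s, c i = 0 := by
  classical
  intro i hi
  obtain ⟨g, hg⟩ := LinearMap.exists_leftInverse_of_injective (Finsupp.linearCombination k l)
    (LinearMap.ker_eq_bot_of_injective hl)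
  have hgl : ∀ j, g (l j) i = if j = i then 1 else 0 := by
    intro j
    have := DFunLike.congr_fun hg (Finsupp.single j 1)
    rw [LinearMap.comp_apply, Finsupp.linearCombination_single, one_smul, LinearMap.id_apply] at this
    rw [this, Finsupp.single_apply]
  have := congrArg (TensorProduct.lid k N ∘ (Finsupp.lapply i ∘ₗ g).rTensor N) h
  simpa [hgl, hi] using this

/-! ### The support system of `F_Ψ` -/

section CopSupport

variable (k : Type u) (F : Type v) (Ψ : Type w) [Field k] [Field F] [Algebra k F]

/-- The field structure of `F_Ψ`. -/
abbrev FPow.field [IsDomain (Cop k F Ψ)] : Field (FPow k F Ψ) :=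
  (FPow.isField k F Ψ).toField

attribute [local instance] FPow.field

variable {Ψ}

theorem FPow.perm_algebraMap (σ : Equiv.Perm Ψ) (x : Cop k F Ψ) :
    FPow.perm k F σ (algebraMap (Cop k F Ψ) (FPow k F Ψ) x) = algebraMap _ _ (Cop.perm k F σ x) :=
  IsFractionRing.algEquivOfAlgEquiv_algebraMap _ _

variable {k F} in
theorem FPow.algHom_ext {A : Type*} [CommRing A] [Algebra k A]
    {f g : FPow k F Ψ →ₐ[k] A}
    (h : ∀ i a, f (algebraMap (Cop k F Ψ) (FPow k F Ψ) (Cop.ι k i a)) =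
      g (algebraMap (Cop k F Ψ) (FPow k F Ψ) (Cop.ι k i a))) : f = g := by
  have h1 : f.comp (IsScalarTower.toAlgHom k (Cop k F Ψ) (FPow k F Ψ)) =
      g.comp (IsScalarTower.toAlgHom k (Cop k F Ψ) (FPow k F Ψ)) := Cop.hom_ext k h
  have h2 : (f : FPow k F Ψ →+* A) = g :=
    IsLocalization.ringHom_ext (nonZeroDivisors (Cop k F Ψ))
      (RingHom.ext fun x => DFunLike.congr_fun h1 x)
  exact AlgHom.ext fun x => DFunLike.congr_fun h2 x

theorem Cop.perm_ι (σ : Equiv.Perm Ψ) (i : Ψ) (a : F) :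
    Cop.perm k F σ (Cop.ι k i a) = Cop.ι k (σ i) a := by
  change Cop.lift k (fun i => Cop.ι k (σ i)) (Cop.ι k i a) = _
  rw [Cop.lift_ι]

theorem FPow.perm_ι (σ : Equiv.Perm Ψ) (i : Ψ) (a : F) :
    FPow.perm k F σ (algebraMap (Cop k F Ψ) (FPow k F Ψ) (Cop.ι k i a)) =
      algebraMap (Cop k F Ψ) (FPow k F Ψ) (Cop.ι k (σ i) a) := by
  rw [FPow.perm_algebraMap, Cop.perm_ι]

variable (Ψ) in
/-- The action of the symmetric group of `Ψ` on `F_Ψ` as a homomorphism. -/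
def FPow.permHom : Equiv.Perm Ψ →* (FPow k F Ψ ≃ₐ[k] FPow k F Ψ) where
  toFun := FPow.perm k F
  map_one' := AlgEquiv.coe_toAlgHom_injective (FPow.algHom_ext fun i a => FPow.perm_ι k F 1 i a)
  map_mul' σ τ := AlgEquiv.coe_toAlgHom_injective (FPow.algHom_ext fun i a =>
    (FPow.perm_ι k F (σ * τ) i a).trans (by
      change _ = FPow.perm k F σ (FPow.perm k F τ _)
      rw [FPow.perm_ι, FPow.perm_ι, Equiv.Perm.mul_apply]))

/-- The subalgebra of the coproduct generated by the tensor factors with index in `I`. -/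
def Cop.supported (I : Set Ψ) : Subalgebra k (Cop k F Ψ) :=
  Algebra.adjoin k {x | ∃ i ∈ I, ∃ a : F, Cop.ι k i a = x}

theorem Cop.adjoin_ι_eq_top : Algebra.adjoin k {x | ∃ (i : Ψ) (a : F), Cop.ι k i a = x} = ⊤ := by
  rw [eq_top_iff]
  intro x _
  obtain ⟨p, rfl⟩ := Ideal.Quotient.mk_surjective x
  change Cop.mk k p ∈ _
  induction p using MvPolynomial.induction_on with
  | C c =>
    rw [← MvPolynomial.algebraMap_eq, AlgHom.commutes]
    exact algebraMap_mem _ c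
  | add p q hp hq => rw [map_add]; exact add_mem (hp trivial) (hq trivial)
  | mul_X p n hp =>
    rw [map_mul]
    exact mul_mem (hp trivial) (Algebra.subset_adjoin ⟨n.1, n.2, rfl⟩)

theorem Cop.exists_mem_supported (x : Cop k F Ψ) :
    ∃ I : Set Ψ, I.Finite ∧ x ∈ Cop.supported k F I := by
  have hmono : ∀ {I J : Set Ψ}, I ⊆ J → Cop.supported k F I ≤ Cop.supported k F J :=
    fun h => Algebra.adjoin_mono fun x ⟨i, hi, a, ha⟩ => ⟨i, h hi, a, ha⟩
  have hx : x ∈ Algebra.adjoin k {x | ∃ (i : Ψ) (a : F), Cop.ι k i a = x} :=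
    Cop.adjoin_ι_eq_top k F ▸ Algebra.mem_top
  induction hx using Algebra.adjoin_induction with
  | mem x hx =>
    obtain ⟨i, a, rfl⟩ := hx
    exact ⟨{i}, Set.finite_singleton i, Algebra.subset_adjoin ⟨i, rfl, a, rfl⟩⟩
  | algebraMap c => exact ⟨∅, Set.finite_empty, algebraMap_mem _ c⟩
  | add x y _ _ hx hy =>
    obtain ⟨I, hI, hxI⟩ := hx
    obtain ⟨J, hJ, hyJ⟩ := hy
    exact ⟨I ∪ J, hI.union hJ, add_mem (hmono Set.subset_union_left hxI)
      (hmono Set.subset_union_right hyJ)⟩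
  | mul x y _ _ hx hy =>
    obtain ⟨I, hI, hxI⟩ := hx
    obtain ⟨J, hJ, hyJ⟩ := hy
    exact ⟨I ∪ J, hI.union hJ, mul_mem (hmono Set.subset_union_left hxI)
      (hmono Set.subset_union_right hyJ)⟩

/-- The universal property gives a homomorphism to `Cop ⊗ Cop` that sends the factors indexed by `I`
to the left and all others to the right. It turns a product of elements with disjoint supports into
a pure tensor. -/
theorem Cop.eq_zero_of_sum_mul_eq_zero {I J : Set Ψ} (hIJ : Disjoint I J) {ι : Type*} {s : Finset ι}
    {l c : ι → Cop k F Ψ} (hl : ∀ i, l i ∈ Cop.supported k F I)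
    (hc : ∀ i, c i ∈ Cop.supported k F J) (hli : LinearIndependent k l)
    (h : ∑ i ∈ s, c i * l i = 0) : ∀ i ∈ s, c i = 0 := by
  classical
  let φ : Cop k F Ψ →ₐ[k] Cop k F Ψ ⊗[k] Cop k F Ψ := Cop.lift k fun i =>
    if i ∈ I then Algebra.TensorProduct.includeLeft.comp (Cop.ι k i)
    else Algebra.TensorProduct.includeRight.comp (Cop.ι k i)
  have hφI : ∀ x ∈ Cop.supported k F I, φ x = x ⊗ₜ 1 := by
    intro x hx
    have : Cop.supported k F I ≤ AlgHom.equalizer φ Algebra.TensorProduct.includeLeft := by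
      refine Algebra.adjoin_le ?_
      rintro _ ⟨i, hi, a, rfl⟩
      change φ _ = _
      simp [φ, hi]
    exact this hx
  have hφJ : ∀ x ∈ Cop.supported k F J, φ x = 1 ⊗ₜ x := by
    intro x hx
    have : Cop.supported k F J ≤ AlgHom.equalizer φ Algebra.TensorProduct.includeRight := by
      refine Algebra.adjoin_le ?_
      rintro _ ⟨i, hi, a, rfl⟩
      change φ _ = _
      have hi' : i ∉ I := fun h => Set.disjoint_left.1 hIJ h hi
      simp [φ, hi']
    exact this hx
  have h1 := congrArg φ h
  rw [map_sum, map_zero] at h1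
  have h2 : ∑ i ∈ s, l i ⊗ₜ[k] c i = 0 := by
    rw [← h1]
    refine Finset.sum_congr rfl fun i _ => ?_
    rw [map_mul, hφI _ (hl i), hφJ _ (hc i)]
    simp
  exact eq_zero_of_sum_tmul_eq_zero hli h2

section

variable [IsDomain (Cop k F Ψ)]

/-- The subfield of `F_Ψ` generated by the tensor factors with index in `I`. -/
def FPow.supported (I : Set Ψ) : IntermediateField k (FPow k F Ψ) :=
  IntermediateField.adjoin k
    {x | ∃ i ∈ I, ∃ a : F, algebraMap (Cop k F Ψ) (FPow k F Ψ) (Cop.ι k i a) = x}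

theorem FPow.adjoin_eq_map (I : Set Ψ) :
    Algebra.adjoin k {x | ∃ i ∈ I, ∃ a : F, algebraMap (Cop k F Ψ) (FPow k F Ψ) (Cop.ι k i a) = x} =
      (Cop.supported k F I).map (IsScalarTower.toAlgHom k (Cop k F Ψ) (FPow k F Ψ)) := by
  rw [Cop.supported, AlgHom.map_adjoin]
  congr 1
  ext x
  constructor
  · rintro ⟨i, hi, a, rfl⟩
    exact ⟨_, ⟨i, hi, a, rfl⟩, rfl⟩
  · rintro ⟨_, ⟨i, hi, a, rfl⟩, rfl⟩
    exact ⟨i, hi, a, rfl⟩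

open scoped IntermediateField.algebraAdjoinAdjoin in
/-- Finitely many elements supported on `I` have a common denominator. -/
theorem FPow.exists_common_denominator {I : Set Ψ} {ι : Type*} (s : Finset ι)
    (f : ι → FPow.supported k F (Ψ := Ψ) I) :
    ∃ d : FPow k F Ψ, d ≠ 0 ∧ ∃ x : s → Cop k F Ψ, (∀ i, x i ∈ Cop.supported k F I) ∧
      ∀ i : s, algebraMap (Cop k F Ψ) (FPow k F Ψ) (x i) = d * f i := by
  let f' : ι → IntermediateField.adjoin k
    {x | ∃ i ∈ I, ∃ a : F, algebraMap (Cop k F Ψ) (FPow k F Ψ) (Cop.ι k i a) = x} := f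
  obtain ⟨d, hd⟩ := IsLocalization.exist_integer_multiples (nonZeroDivisors (Algebra.adjoin k
    {x | ∃ i ∈ I, ∃ a : F, algebraMap (Cop k F Ψ) (FPow k F Ψ) (Cop.ι k i a) = x})) s f'
  have hx : ∀ i : s, ∃ x ∈ Cop.supported k F I,
      algebraMap (Cop k F Ψ) (FPow k F Ψ) x = (d : FPow k F Ψ) * f i := by
    intro i
    obtain ⟨y, hy⟩ := hd i i.2
    obtain ⟨x, hx, hxy⟩ := (FPow.adjoin_eq_map k F I).le y.2
    exact ⟨x, hx, hxy.trans (congrArg Subtype.val hy)⟩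
  choose x hx hxf using hx
  refine ⟨d, fun h => nonZeroDivisors.coe_ne_zero d (Subtype.ext h), x, hx, hxf⟩

theorem FPow.supportSystem : SupportSystem (FPow.permHom k F Ψ) (FPow.supported k F) where
  union I J := by
    rw [FPow.supported, FPow.supported, FPow.supported, ← IntermediateField.adjoin_union]
    congr 1
    ext x
    constructor
    · rintro ⟨i, hi | hi, h⟩
      · exact Or.inl ⟨i, hi, h⟩
      · exact Or.inr ⟨i, hi, h⟩
    · rintro (⟨i, hi, h⟩ | ⟨i, hi, h⟩)
      · exact ⟨i, Or.inl hi, h⟩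
      · exact ⟨i, Or.inr hi, h⟩
  exists_mem x := by
    obtain ⟨a, b, hb, rfl⟩ := IsFractionRing.div_surjective (A := Cop k F Ψ) x
    obtain ⟨I, hI, ha⟩ := Cop.exists_mem_supported k F a
    obtain ⟨J, hJ, hb⟩ := Cop.exists_mem_supported k F b
    have key : ∀ (T : Set Ψ) (y : Cop k F Ψ), T ⊆ I ∪ J → y ∈ Cop.supported k F T →
        algebraMap (Cop k F Ψ) (FPow k F Ψ) y ∈ FPow.supported k F (I ∪ J) := by
      intro T y hT hy
      have h1 := IntermediateField.algebra_adjoin_le_adjoin k _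
        ((FPow.adjoin_eq_map k F T).ge (Subalgebra.mem_map.2 ⟨y, hy, rfl⟩))
      refine IntermediateField.adjoin.mono k _ _ ?_ h1
      rintro x ⟨i, hi, h⟩
      exact ⟨i, hT hi, h⟩
    exact ⟨I ∪ J, hI.union hJ, div_mem (key I a Set.subset_union_left ha)
      (key J b Set.subset_union_right hb)⟩
  map_mem g I x hx := by
    have : FPow.supported k F I ≤ IntermediateField.comap
        (FPow.permHom k F Ψ g : FPow k F Ψ →ₐ[k] FPow k F Ψ) (FPow.supported k F (g '' I)) := by
      refine IntermediateField.adjoin_le_iff.2 ?_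
      rintro _ ⟨i, hi, a, rfl⟩
      exact IntermediateField.subset_adjoin _ _ ⟨g i, ⟨i, hi, rfl⟩, a, (FPow.perm_ι k F g i a).symm⟩
    exact this hx
  fixed g I x hg hx := by
    induction hx using IntermediateField.adjoin_induction with
    | mem x hx =>
      obtain ⟨i, hi, a, rfl⟩ := hx
      exact (FPow.perm_ι k F g i a).trans (by rw [hg i hi])
    | algebraMap c => exact AlgEquiv.commutes _ c
    | add x y _ _ hx hy => rw [map_add, hx, hy]
    | inv x _ hx => rw [map_inv₀, hx]
    | mul x y _ _ hx hy => rw [map_mul, hx, hy]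
  disjoint I J hIJ := by
    let b := Module.Free.chooseBasis k (FPow.supported k F (Ψ := Ψ) I)
    refine IntermediateField.LinearDisjoint.of_basis_left b ?_
    rw [linearIndependent_iff']
    intro s c hc i hi
    -- Linear disjointness is checked in the coproduct: clear the denominators of the basis elements
    -- and of the coefficients separately, which changes neither the supports nor the independence.
    obtain ⟨d, hd, x, hxI, hx⟩ := FPow.exists_common_denominator k F s b
    obtain ⟨e, he, y, hyJ, hy⟩ := FPow.exists_common_denominator k F s c
    have hli : LinearIndependent k x := by
      have h1 : LinearIndependent k (fun i : s => d * (b i : FPow k F Ψ)) :=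
        ((b.linearIndependent.comp _ Subtype.val_injective).map'
          ((LinearMap.mulLeft k d).comp (FPow.supported k F I).val.toLinearMap)
          (LinearMap.ker_eq_bot_of_injective fun u v huv =>
            Subtype.ext (mul_left_cancel₀ hd huv)))
      refine LinearIndependent.of_comp
        (IsScalarTower.toAlgHom k (Cop k F Ψ) (FPow k F Ψ)).toLinearMap ?_
      convert h1 using 1
      exact funext hx
    have h0 := Cop.eq_zero_of_sum_mul_eq_zero k F hIJ (s := Finset.univ) hxI hyJ hli (by
      apply IsFractionRing.injective (Cop k F Ψ) (FPow k F Ψ)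
      have h2 := congrArg (fun z => e * d * z) hc
      simp only [mul_zero] at h2
      rw [map_zero, map_sum, ← h2, ← Finset.sum_coe_sort s, Finset.mul_sum]
      refine Finset.sum_congr rfl fun j _ => ?_
      rw [map_mul, hx, hy, IntermediateField.smul_def, smul_eq_mul, Function.comp_apply]
      change _ = e * d * (_ * (b j : FPow k F Ψ))
      ring) ⟨i, hi⟩ (Finset.mem_univ _)
    have h3 := hy ⟨i, hi⟩
    rw [h0, map_zero] at h3
    exact Subtype.ext ((mul_eq_zero.1 h3.symm).resolve_left he)

end

end CopSupport

/-! ### Regular extensions and tensor products -/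

section Regular

/-- A field extension that is separable in the sense of MacLane, and in which the base field is
algebraically closed. -/
structure IsRegularExtension (k : Type*) (L : Type v) [Field k] [Field L] [Algebra k L] :
    Prop where
  linearIndependent_pow : ∀ (p : ℕ) [ExpChar k p] {ι : Type v} (l : ι → L),
    LinearIndependent k l → LinearIndependent k (fun i => l i ^ p)
  mem_bot : ∀ x : L, IsAlgebraic k x → x ∈ (⊥ : IntermediateField k L)

variable {k : Type*} {L : Type v} [Field k] [Field L] [Algebra k L]

/-- Nullstellensatz: a nonzero element of a finitely generated domain has a nonzero value at some
point with coordinates in a finite extension. -/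
theorem exists_algHom_finite_ne_zero {k : Type*} {D : Type u} [Field k] [CommRing D] [Algebra k D]
    [Algebra.FiniteType k D] {a : D} (ha : ¬ IsNilpotent a) :
    ∃ (κ : Type u) (_ : Field κ) (_ : Algebra k κ) (φ : D →ₐ[k] κ),
      FiniteDimensional k κ ∧ φ a ≠ 0 := by
  have : Nontrivial (Localization.Away a) := by
    rw [← not_subsingleton_iff_nontrivial, IsLocalization.subsingleton_iff (M := Submonoid.powers a)]
    exact ha
  have : Algebra.FiniteType D (Localization.Away a) := IsLocalization.finiteType_of_monoid_fg (Submonoid.powers a) _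
  have : Algebra.FiniteType k (Localization.Away a) := Algebra.FiniteType.trans (S := D) ‹_› ‹_›
  obtain ⟨m, hm⟩ := Ideal.exists_maximal (Localization.Away a)
  let := Ideal.Quotient.field m
  refine ⟨Localization.Away a ⧸ m, inferInstance, inferInstance,
    (Ideal.Quotient.mkₐ k m).comp (IsScalarTower.toAlgHom k D (Localization.Away a)),
    finite_of_finite_type_of_isJacobsonRing k _, ?_⟩
  exact ((IsLocalization.Away.algebraMap_isUnit (S := Localization.Away a) a).map
    (Ideal.Quotient.mkₐ k m)).ne_zero

/-- In a basis `b` of `L`, the `p`-th power of `∑ b i ⊗ c i` is `∑ b i ^ p ⊗ c i ^ p`, and the `b i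
^ p` are still independent. -/
theorem eq_zero_of_pow_eq_zero_of_linearIndependent_pow (h : IsRegularExtension k L)
    (p : ℕ) [ExpChar k p] {A : Type*} [CommRing A] [IsDomain A] [Algebra k A] {x : L ⊗[k] A} (hx : x ^ p = 0) :
    x = 0 := by
  classical
  let b := Module.Free.chooseBasis k L
  obtain ⟨c, rfl⟩ := (TensorProduct.equivFinsuppOfBasisLeft (N := A) b).symm.surjective x
  have : ExpChar (L ⊗[k] A) p :=
    expChar_of_injective_algebraMap (algebraMap k (L ⊗[k] A)).injective p
  rw [TensorProduct.equivFinsuppOfBasisLeft_symm_apply, Finsupp.sum] at hx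
  rw [sum_pow_char p] at hx
  simp only [Algebra.TensorProduct.tmul_pow] at hx
  have h0 := eq_zero_of_sum_tmul_eq_zero (h.linearIndependent_pow p _ b.linearIndependent) hx
  have : c = 0 := by
    ext i
    by_contra hi
    exact hi (pow_eq_zero_iff (expChar_pos k p).ne' |>.1 (h0 i (Finsupp.mem_support_iff.2 hi)))
  rw [this, map_zero]

/-- A primitive element has the same degree over `L` as over `k`, so the tensor product embeds in an
algebraic closure of `L`. -/
theorem isDomain_tensorProduct_of_isSeparable (h : IsRegularExtension k L)
    (κ : Type*) [Field κ] [Algebra k κ] [FiniteDimensional k κ] [Algebra.IsSeparable k κ] :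
    IsDomain (L ⊗[k] κ) := by
  let pb := Field.powerBasisOfFiniteOfSeparable k κ
  let f : κ →ₐ[k] AlgebraicClosure L := IsAlgClosed.lift
  set y := f pb.gen with hy
  have hyint : IsIntegral k y := (Algebra.IsIntegral.isIntegral pb.gen).map f
  have hyint' : IsIntegral L y := hyint.tower_top
  -- The minimal polynomial over `L` divides the one over `k`, so its coefficients are integral over
  -- `k`; being in `L`, they lie in `k`.
  have hcoeff : ∀ i, (minpoly L y).coeff i ∈ (algebraMap k L).range := by
    intro i
    have h1 := Polynomial.isIntegral_coeff_of_dvd (minpoly k y) (minpoly L y) (minpoly.monic hyint)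
      (minpoly.monic hyint') (minpoly.dvd_map_of_isScalarTower k L y) i
    exact IntermediateField.mem_bot.1 (h.mem_bot _ h1.isAlgebraic)
  obtain ⟨q, hq, hdeg, hmonic⟩ := Polynomial.lifts_and_natDegree_eq_and_monic
    ((Polynomial.lifts_iff_coeff_lifts _).2 hcoeff) (minpoly.monic hyint')
  have hq0 : Polynomial.aeval y q = 0 := by
    rw [← Polynomial.aeval_map_algebraMap L, hq, minpoly.aeval]
  have hle : pb.dim ≤ (minpoly L y).natDegree := by
    rw [← hdeg, ← pb.natDegree_minpoly, ← minpoly.algHom_eq f f.injective]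
    exact Polynomial.natDegree_le_of_dvd (minpoly.dvd k y hq0) hmonic.ne_zero
  have hli : LinearIndependent L (fun i => f (pb.basis i)) := by
    have h1 := (linearIndependent_pow (K := L) y).comp (Fin.castLE hle) (Fin.castLE_injective hle)
    convert h1 using 1
    ext i
    simp [hy]
  exact (productMap_injective_of_linearIndependent f pb.basis hli).isDomain
    (Algebra.TensorProduct.productMap (IsScalarTower.toAlgHom k L (AlgebraicClosure L)) f).toRingHom

/-- Over the separable closure the tensor product is a domain. A `p`-power of every element comes
from there, and there are no nilpotents, so a vanishing product makes one of its factors vanish. -/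
theorem isDomain_tensorProduct_of_finiteDimensional (h : IsRegularExtension k L)
    (κ : Type*) [Field κ] [Algebra k κ] [FiniteDimensional k κ] : IsDomain (L ⊗[k] κ) := by
  have hdom : IsDomain (L ⊗[k] separableClosure k κ) :=
    isDomain_tensorProduct_of_isSeparable h (separableClosure k κ)
  have hnzd : NoZeroDivisors (L ⊗[k] separableClosure k κ) := hdom.to_noZeroDivisors
  obtain ⟨p, hp⟩ := ExpChar.exists k
  let j : L ⊗[k] (separableClosure k κ) →ₐ[k] L ⊗[k] κ := Algebra.TensorProduct.map (AlgHom.id k L) (separableClosure k κ).val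
  have hj : Function.Injective j :=
    Module.Flat.lTensor_preserves_injective_linearMap (separableClosure k κ).val.toLinearMap (separableClosure k κ).val.injective
  have : ExpChar (L ⊗[k] κ) p :=
    expChar_of_injective_algebraMap (algebraMap k (L ⊗[k] κ)).injective p
  have : ExpChar (separableClosure k κ) p := expChar_of_injective_algebraMap (algebraMap k (separableClosure k κ)).injective p
  have hmono : ∀ (z : L ⊗[k] κ) (n m : ℕ), n ≤ m → z ^ p ^ n ∈ j.range → z ^ p ^ m ∈ j.range := by
    intro z n m hnm hz
    obtain ⟨d, rfl⟩ := Nat.exists_eq_add_of_le hnm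
    rw [pow_add, pow_mul]
    exact pow_mem hz _
  have hroot : ∀ z : L ⊗[k] κ, ∃ n : ℕ, z ^ p ^ n ∈ j.range := by
    intro z
    induction z using TensorProduct.induction_on with
    | zero => exact ⟨0, by simp⟩
    | tmul l a =>
      obtain ⟨n, c, hc⟩ := IsPurelyInseparable.pow_mem (separableClosure k κ) p a
      refine ⟨n, (l ^ p ^ n) ⊗ₜ c, ?_⟩
      rw [Algebra.TensorProduct.tmul_pow, ← hc]
      rfl
    | add x y hx hy =>
      obtain ⟨n, hn⟩ := hx
      obtain ⟨m, hm⟩ := hy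
      refine ⟨max n m, ?_⟩
      rw [add_pow_expChar_pow]
      exact add_mem (hmono _ _ _ (le_max_left _ _) hn) (hmono _ _ _ (le_max_right _ _) hm)
  have hzero : ∀ (n : ℕ) (z : L ⊗[k] κ), z ^ p ^ n = 0 → z = 0 := by
    intro n
    induction n with
    | zero => intro z hz; simpa using hz
    | succ n ih =>
      intro z hz
      rw [pow_succ, pow_mul] at hz
      exact ih z (eq_zero_of_pow_eq_zero_of_linearIndependent_pow h p hz)
  have : NoZeroDivisors (L ⊗[k] κ) := by
    refine ⟨fun {x y} hxy => ?_⟩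
    obtain ⟨n, hn⟩ := hroot x
    obtain ⟨m, hm⟩ := hroot y
    obtain ⟨a, ha⟩ := hmono _ _ _ (le_max_left n m) hn
    obtain ⟨b, hb⟩ := hmono _ _ _ (le_max_right n m) hm
    have h0 : a * b = 0 := hj (by
      rw [map_zero, map_mul]
      change j a = _ at ha
      change j b = _ at hb
      rw [ha, hb, ← mul_pow, hxy, zero_pow (pow_pos (expChar_pos k p) _).ne'])
    rcases hnzd.eq_zero_or_eq_zero_of_mul_eq_zero h0 with rfl | rfl
    · exact Or.inl (hzero _ _ (ha.symm.trans (map_zero j)))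
    · exact Or.inr (hzero _ _ (hb.symm.trans (map_zero j)))
  exact NoZeroDivisors.to_isDomain _

/-- A field extension with the properties of a regular extension stays a domain after tensoring
with any domain. -/
theorem isDomain_tensorProduct (h : IsRegularExtension k L)
    (D : Type*) [CommRing D] [IsDomain D] [Algebra k D] : IsDomain (L ⊗[k] D) := by
  classical
  let b := Module.Free.chooseBasis k L
  have : NoZeroDivisors (L ⊗[k] D) := by
    refine ⟨fun {x y} hxy => ?_⟩
    by_contra! hne
    obtain ⟨c, rfl⟩ := (TensorProduct.equivFinsuppOfBasisLeft (N := D) b).symm.surjective x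
    obtain ⟨d, rfl⟩ := (TensorProduct.equivFinsuppOfBasisLeft (N := D) b).symm.surjective y
    obtain ⟨i, hi⟩ := Finsupp.ne_iff.1 (fun h => hne.1 (by rw [h, map_zero]) : c ≠ 0)
    obtain ⟨j, hj⟩ := Finsupp.ne_iff.1 (fun h => hne.2 (by rw [h, map_zero]) : d ≠ 0)
    -- The two factors have coordinates in a finitely generated subdomain. Specialising it to a
    -- finite extension where one coordinate of each stays nonzero contradicts the finite case.
    let D₀ := Algebra.adjoin k ((c.support.image c ∪ d.support.image d : Finset D) : Set D)
    have hc : ∀ i, c i ∈ D₀ := by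
      intro i
      by_cases h : c i = 0
      · rw [h]; exact zero_mem _
      · exact Algebra.subset_adjoin (Finset.mem_coe.2 (Finset.mem_union_left _
          (Finset.mem_image_of_mem _ (Finsupp.mem_support_iff.2 h))))
    have hd : ∀ i, d i ∈ D₀ := by
      intro i
      by_cases h : d i = 0
      · rw [h]; exact zero_mem _
      · exact Algebra.subset_adjoin (Finset.mem_coe.2 (Finset.mem_union_right _
          (Finset.mem_image_of_mem _ (Finsupp.mem_support_iff.2 h))))
    have : Algebra.FiniteType k D₀ := (Subalgebra.fg_iff_finiteType D₀).1 ⟨_, rfl⟩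
    obtain ⟨κ, _, _, φ, _, hφ⟩ := exists_algHom_finite_ne_zero (k := k)
      (a := (⟨c i, hc i⟩ * ⟨d j, hd j⟩ : D₀)) (by
        rw [isNilpotent_iff_eq_zero]
        exact fun h => mul_ne_zero hi hj (congrArg Subtype.val h))
    have := isDomain_tensorProduct_of_finiteDimensional h κ
    have hinj : Function.Injective (Algebra.TensorProduct.map (AlgHom.id k L) D₀.val) :=
      Module.Flat.lTensor_preserves_injective_linearMap D₀.val.toLinearMap
        Subtype.val_injective
    have hval : ∀ (e : Module.Free.ChooseBasisIndex k L →₀ D) (he : ∀ i, e i ∈ D₀),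
        (TensorProduct.equivFinsuppOfBasisLeft (N := D) b).symm e =
          Algebra.TensorProduct.map (AlgHom.id k L) D₀.val
            (∑ i ∈ e.support, b i ⊗ₜ ⟨e i, he i⟩) := by
      intro e he
      rw [TensorProduct.equivFinsuppOfBasisLeft_symm_apply, Finsupp.sum, map_sum]
      rfl
    have hne : ∀ (e : Module.Free.ChooseBasisIndex k L →₀ D) (he : ∀ i, e i ∈ D₀)
        (i : Module.Free.ChooseBasisIndex k L), φ ⟨e i, he i⟩ ≠ 0 →
        Algebra.TensorProduct.map (AlgHom.id k L) φ (∑ i ∈ e.support, b i ⊗ₜ ⟨e i, he i⟩) ≠ 0 := by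
      intro e he i hi h0
      rw [map_sum] at h0
      refine hi (eq_zero_of_sum_tmul_eq_zero b.linearIndependent
        (c := fun i => φ ⟨e i, he i⟩) h0 i (Finsupp.mem_support_iff.2 fun h => hi ?_))
      have : (⟨e i, he i⟩ : D₀) = 0 := Subtype.ext h
      rw [this, map_zero]
    rw [map_mul] at hφ
    rw [hval c hc, hval d hd, ← map_mul] at hxy
    have h0 := congrArg (Algebra.TensorProduct.map (AlgHom.id k L) φ)
      (hinj (hxy.trans (map_zero _).symm))
    rw [map_mul, map_zero] at h0
    exact (mul_eq_zero.1 h0).elim (hne c hc i (left_ne_zero_of_mul hφ))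
      (hne d hd j (right_ne_zero_of_mul hφ))
  exact NoZeroDivisors.to_isDomain _

end Regular

/-! ### Affine models of varieties -/

section Schemes

variable {k : Type u} [Field k]

/-- The morphism of affine schemes attached to an algebra. -/
abbrev specMap (R S : Type u) [CommRing R] [CommRing S] [Algebra R S] :
    Spec (.of S) ⟶ Spec (.of R) := Spec.map (CommRingCat.ofHom (algebraMap R S))

theorem geometricallyIrreducible_specMap_iff {A : Type u} [CommRing A] [Algebra k A] :
    GeometricallyIrreducible (specMap k A) ↔
      ∀ (E : Type u) [Field E] [Algebra k E], (nilradical (A ⊗[k] E)).IsPrime := by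
  rw [geometricallyIrreducible_iff, geometrically_iff_of_commRing_of_isClosedUnderIsomorphisms]
  refine forall_congr' fun E => forall_congr' fun _ => forall_congr' fun _ => ?_
  rw [← PrimeSpectrum.irreducibleSpace_iff_isPrime_nilradical]
  exact (pullbackSpecIso k A E).hom.homeomorph.irreducibleSpace_iff

theorem AbsIrredVariety.exists_affine (Y : AbsIrredVariety k) :
    ∃ (A : Type u) (_ : CommRing A) (_ : IsDomain A) (_ : Algebra k A) (_ : Algebra A Y.FunField)
      (i : Spec (.of A) ⟶ Y.X), Algebra.FiniteType k A ∧ IsScalarTower k A Y.FunField ∧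
        IsFractionRing A Y.FunField ∧ IsOpenImmersion i ∧ i ≫ Y.str = specMap k A := by
  obtain ⟨U, hU, hx, -⟩ := exists_isAffineOpen_mem_and_subset (X := Y.X) (U := ⊤)
    (x := genericPoint Y.X) trivial
  have : Nonempty U := ⟨⟨_, hx⟩⟩
  let φ : CommRingCat.of k ⟶ Γ(Y.X, U) := (Scheme.ΓSpecIso (.of k)).inv ≫ Y.str.appTop ≫
    Y.X.presheaf.map (homOfLE le_top).op
  let : Algebra k Γ(Y.X, U) := φ.hom.toAlgebra
  have hstr : hU.fromSpec ≫ Y.str = Spec.map φ := by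
    rw [← cancel_mono (Spec (.of k)).toSpecΓ, Category.assoc, Scheme.toSpecΓ_naturality,
      hU.fromSpec_toSpecΓ_assoc, ← SpecMap_ΓSpecIso_hom, ← Spec.map_comp, ← Spec.map_comp]
    simp [φ]
  refine ⟨Γ(Y.X, U), inferInstance, inferInstance, inferInstance,
    (inferInstance : Algebra Γ(Y.X, U) Y.X.functionField), hU.fromSpec, ?_, ?_, ?_, ?_, ?_⟩
  · have : LocallyOfFiniteType (Spec.map φ) := hstr ▸ inferInstance
    exact (HasRingHomProperty.Spec_iff (P := @LocallyOfFiniteType)).1 this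
  · let : Algebra Γ(Y.X, U) Y.FunField := (inferInstance : Algebra Γ(Y.X, U) Y.X.functionField)
    refine IsScalarTower.of_algebraMap_eq' ?_
    change ((Scheme.ΓSpecIso (.of k)).inv ≫ Y.str.appTop ≫
      Y.X.presheaf.germ ⊤ (genericPoint Y.X) trivial).hom =
        (φ ≫ Y.X.presheaf.germ U (genericPoint Y.X) hx).hom
    simp only [φ, Category.assoc, TopCat.Presheaf.germ_res]
  · exact functionField_isFractionRing_of_isAffineOpen Y.X U hU
  · infer_instance
  · exact hstr

/-- The affine variety attached to a finitely generated, geometrically irreducible domain. -/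
def AbsIrredVariety.ofAlgebra (A : Type u) [CommRing A] [IsDomain A] [Algebra k A]
    [Algebra.FiniteType k A]
    (h : ∀ (E : Type u) [Field E] [Algebra k E], (nilradical (A ⊗[k] E)).IsPrime) :
    AbsIrredVariety k where
  X := Spec (.of A)
  str := specMap k A
  integral := inferInstance
  separated := inferInstance
  locallyOfFiniteType := (HasRingHomProperty.Spec_iff (P := @LocallyOfFiniteType)).2
    (RingHom.finiteType_algebraMap.2 inferInstance)
  quasiCompact := inferInstance
  geometricallyIrreducible := geometricallyIrreducible_specMap_iff.2 h

theorem AbsIrredVariety.ofAlgebra_funField (A : Type u) [CommRing A] [IsDomain A] [Algebra k A]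
    [Algebra.FiniteType k A]
    (h : ∀ (E : Type u) [Field E] [Algebra k E], (nilradical (A ⊗[k] E)).IsPrime) :
    ∃ (_ : Algebra A (AbsIrredVariety.ofAlgebra A h).FunField),
      IsScalarTower k A (AbsIrredVariety.ofAlgebra A h).FunField ∧
        IsFractionRing A (AbsIrredVariety.ofAlgebra A h).FunField := by
  refine ⟨@AlgebraicGeometry.instAlgebraCarrierFunctionFieldSpec (.of A) ‹IsDomain A›, ?_,
    @AlgebraicGeometry.functionField_isFractionRing_of_affine (.of A) ‹IsDomain A›⟩
  let : Algebra A (AbsIrredVariety.ofAlgebra A h).FunField :=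
    @AlgebraicGeometry.instAlgebraCarrierFunctionFieldSpec (.of A) ‹IsDomain A›
  refine IsScalarTower.of_algebraMap_eq' ?_
  change ((Scheme.ΓSpecIso (.of k)).inv ≫ (specMap k A).appTop ≫
      (Spec (.of A)).presheaf.germ ⊤ (genericPoint _) trivial).hom =
        (CommRingCat.ofHom (algebraMap k A) ≫ StructureSheaf.toStalk A (genericPoint (Spec (.of A)))).hom
  exact congrArg (fun f => CommRingCat.Hom.hom
    (f ≫ (Spec (.of A)).presheaf.germ ⊤ (genericPoint (Spec (.of A))) trivial))
    (Scheme.ΓSpecIso_inv_naturality (CommRingCat.ofHom (algebraMap k A))).symm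

/-- A dense affine open subscheme of the base change of a variety. -/
theorem AbsIrredVariety.birationalOver_baseChange (Y : AbsIrredVariety k) {A : Type u} [CommRing A]
    [Algebra k A] (i : Spec (.of A) ⟶ Y.X) [IsOpenImmersion i] (hi : i ≫ Y.str = specMap k A)
    (k' : Type u) [Field k'] [Algebra k k'] (s : A ⊗[k] k')
    (R : Type u) [CommRing R] [Nontrivial R] [Algebra (A ⊗[k] k') R] [IsLocalization.Away s R] [Algebra k' R]
    (hR : algebraMap k' R = (algebraMap (A ⊗[k] k') R).comp
      (Algebra.TensorProduct.includeRight (R := k) (A := A) (B := k')).toRingHom) :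
    Scheme.BirationalOver (specMap k' R) (Y.baseChange k') := by
  have : IsOpenImmersion (specMap (A ⊗[k] k') R) := IsOpenImmersion.of_isLocalization s
  let g : Limits.pullback (specMap k A) (specMap k k') ⟶ Limits.pullback Y.str (specMap k k') :=
    Limits.pullback.map _ _ _ _ i (𝟙 _) (𝟙 _) (by simp [hi]) (by simp)
  have : IsOpenImmersion g := by
    dsimp only [g]
    infer_instance
  let f : Spec (.of R) ⟶ Limits.pullback Y.str (specMap k k') :=
    specMap (A ⊗[k] k') R ≫ (pullbackSpecIso k A k').inv ≫ g
  have : IrreducibleSpace ↥(Limits.pullback Y.str (specMap k k')) :=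
    Y.geometricallyIrreducible.geometrically_irreducibleSpace _ _ _ (.of_hasPullback _ _)
  -- The base change is irreducible and `R` is nontrivial, so the open image is nonempty and hence
  -- dense.
  have : IsDominant f := ⟨f.isOpenEmbedding.isOpen_range.dense (Set.range_nonempty _)⟩
  refine Scheme.Hom.birationalOver f _ _ ?_
  simp only [f, g, Category.assoc, AbsIrredVariety.baseChange]
  rw [Limits.pullback.lift_snd, Category.comp_id, pullbackSpecIso_inv_snd, ← Spec.map_comp]
  congr 1
  ext x
  exact (DFunLike.congr_fun hR x).symm

end Schemes

/-! ### Irreducibility of tensor products, via prime nilradicals -/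

section NilradicalPrime

theorem isPrime_nilradical_of_injective {R S : Type*} [CommRing R] [CommRing S] (f : R →+* S)
    (hf : Function.Injective f) (h : (nilradical S).IsPrime) : (nilradical R).IsPrime := by
  have : nilradical R = (nilradical S).comap f := by
    ext x
    rw [Ideal.mem_comap, mem_nilradical, mem_nilradical, IsNilpotent.map_iff hf]
  rw [this]
  exact h.comap f

theorem isPrime_nilradical_of_surjective {R S : Type*} [CommRing R] [CommRing S] [IsDomain S]
    (f : R →+* S) (hf : RingHom.ker f ≤ nilradical R) : (nilradical R).IsPrime := by
  have : nilradical R = RingHom.ker f := by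
    refine le_antisymm (fun x hx => ?_) hf
    exact ((mem_nilradical.1 hx).map f).eq_zero
  rw [this]
  exact RingHom.ker_isPrime f

/-- Modulo the nilradical of `N` the tensor product is a domain, and the kernel of that reduction is
generated by nilpotents. -/
theorem isPrime_nilradical_tensorProduct {k : Type*} {L : Type v} [Field k] [Field L] [Algebra k L]
    (h : IsRegularExtension k L) {N : Type*} [CommRing N] [Algebra k N]
    (hN : (nilradical N).IsPrime) : (nilradical (L ⊗[k] N)).IsPrime := by
  let π := Ideal.Quotient.mkₐ k (nilradical N)
  have := isDomain_tensorProduct h (N ⧸ nilradical N)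
  refine isPrime_nilradical_of_surjective
    (Algebra.TensorProduct.map (AlgHom.id k L) π).toRingHom ?_
  change RingHom.ker (Algebra.TensorProduct.map (AlgHom.id k L) π) ≤ _
  rw [Algebra.TensorProduct.lTensor_ker _ (Ideal.Quotient.mkₐ_surjective k _), Ideal.map_le_iff_le_comap]
  intro x hx
  have hx : x ∈ nilradical N := Ideal.Quotient.eq_zero_iff_mem.1 hx
  exact (mem_nilradical.1 hx).map Algebra.TensorProduct.includeRight

/-- Up to a unit `d ⊗ 1`, every element of `K ⊗ E` comes from `D ⊗ E`, and the inclusion preserves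
and reflects nilpotency. -/
theorem isPrime_nilradical_fractionRing_tensorProduct {k D K E : Type*} [Field k] [CommRing D]
    [IsDomain D] [Field K] [Algebra k D] [Algebra k K] [Algebra D K] [IsScalarTower k D K]
    [IsFractionRing D K] [CommRing E] [Algebra k E] (h : (nilradical (D ⊗[k] E)).IsPrime) :
    (nilradical (K ⊗[k] E)).IsPrime := by
  let j : D ⊗[k] E →ₐ[k] K ⊗[k] E :=
    Algebra.TensorProduct.map (IsScalarTower.toAlgHom k D K) (AlgHom.id k E)
  have hj : Function.Injective j := Module.Flat.rTensor_preserves_injective_linearMap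
    (IsScalarTower.toAlgHom k D K).toLinearMap (IsFractionRing.injective D K)
  have hs : ∀ z : K ⊗[k] E, ∃ d : D, d ≠ 0 ∧ ∃ w, (algebraMap D K d ⊗ₜ[k] (1 : E)) * z = j w := by
    intro z
    induction z using TensorProduct.induction_on with
    | zero => exact ⟨1, one_ne_zero, 0, by simp⟩
    | tmul x e =>
      obtain ⟨c, d, hd, rfl⟩ := IsFractionRing.div_surjective (A := D) x
      refine ⟨d, nonZeroDivisors.ne_zero hd, c ⊗ₜ e, ?_⟩
      have : algebraMap D K d ≠ 0 := by
        simpa using nonZeroDivisors.ne_zero hd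
      rw [Algebra.TensorProduct.tmul_mul_tmul, mul_div_cancel₀ _ this, one_mul]
      rfl
    | add x y hx hy =>
      obtain ⟨d, hd, c, hc⟩ := hx
      obtain ⟨d', hd', c', hc'⟩ := hy
      refine ⟨d * d', mul_ne_zero hd hd', (d' ⊗ₜ 1) * c + (d ⊗ₜ 1) * c', ?_⟩
      rw [map_add, map_mul, map_mul, map_mul, ← hc, ← hc', mul_add]
      have hm : (algebraMap D K d * algebraMap D K d') ⊗ₜ[k] (1 : E) =
          (algebraMap D K d ⊗ₜ[k] 1) * (algebraMap D K d' ⊗ₜ[k] 1) := by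
        rw [Algebra.TensorProduct.tmul_mul_tmul, one_mul]
      simp only [j, Algebra.TensorProduct.map_tmul, map_one, IsScalarTower.coe_toAlgHom', hm]
      ring
  have hu : ∀ d : D, d ≠ 0 → IsUnit (algebraMap D K d ⊗ₜ[k] (1 : E)) := by
    intro d hd
    exact (IsUnit.mk0 (algebraMap D K d) (by simpa using hd)).map
      (Algebra.TensorProduct.includeLeft : K →ₐ[k] K ⊗[k] E)
  have key : ∀ z w d, d ≠ 0 → (algebraMap D K d ⊗ₜ[k] (1 : E)) * z = j w →
      (w ∈ nilradical (D ⊗[k] E) ↔ z ∈ nilradical (K ⊗[k] E)) := by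
    intro z w d hd hz
    rw [mem_nilradical, mem_nilradical, ← IsNilpotent.map_iff hj, ← hz]
    exact (hu d hd).isNilpotent_unit_mul_of_commute_iff (Commute.all _ _)
  refine ⟨fun htop => h.ne_top ?_, fun {x y} hxy => ?_⟩
  · rw [Ideal.eq_top_iff_one, mem_nilradical] at htop ⊢
    rwa [← IsNilpotent.map_iff hj, map_one]
  · obtain ⟨d, hd, c, hc⟩ := hs x
    obtain ⟨d', hd', c', hc'⟩ := hs y
    rw [← key x c d hd hc, ← key y c' d' hd' hc']
    refine h.mem_or_mem ((key (x * y) (c * c') (d * d') (mul_ne_zero hd hd') ?_).2 hxy)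
    rw [map_mul, map_mul, ← hc, ← hc', ← mul_mul_mul_comm, Algebra.TensorProduct.tmul_mul_tmul, one_mul]

end NilradicalPrime

/-! ### Common localizations of finitely generated subalgebras -/

section SpreadingOut

/-- Serves to move subalgebras of `L` or `K` into the universe of `k`, where the schemes live. -/
theorem exists_algEquiv_of_fg {k : Type u} {K : Type*} [Field k] [CommRing K] [Algebra k K]
    (C : Subalgebra k K) (hC : C.FG) :
    ∃ (C₀ : Type u) (_ : CommRing C₀) (_ : Algebra k C₀),
      Algebra.FiniteType k C₀ ∧ Nonempty (C₀ ≃ₐ[k] C) := by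
  have := (Subalgebra.fg_iff_finiteType C).1 hC
  obtain ⟨n, f, hf⟩ := Algebra.FiniteType.iff_quotient_mvPolynomial''.1 this
  exact ⟨_, inferInstance, inferInstance, inferInstanceAs (Algebra.FiniteType k (_ ⧸ RingHom.ker f)),
    ⟨Ideal.quotientKerAlgEquivOfSurjective hf⟩⟩

section Subalgebras

variable {k K : Type*} [Field k] [Field K] [Algebra k K] {U V : Subalgebra k K}

theorem exists_pow_mul_mem_of_mem_adjoin {s : K} (hs : s ∈ U) {T : Set K}
    (hT : ∀ t ∈ T, ∃ n : ℕ, s ^ n * t ∈ U) {x : K} (hx : x ∈ Algebra.adjoin k T) :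
    ∃ n : ℕ, s ^ n * x ∈ U := by
  induction hx using Algebra.adjoin_induction with
  | mem x hx => exact hT x hx
  | algebraMap r => exact ⟨0, by simp⟩
  | add x y _ _ hx hy =>
    obtain ⟨n, hn⟩ := hx
    obtain ⟨m, hm⟩ := hy
    refine ⟨n + m, ?_⟩
    rw [show s ^ (n + m) * (x + y) = s ^ m * (s ^ n * x) + s ^ n * (s ^ m * y) by ring]
    exact add_mem (mul_mem (pow_mem hs _) hn) (mul_mem (pow_mem hs _) hm)
  | mul x y _ _ hx hy =>
    obtain ⟨n, hn⟩ := hx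
    obtain ⟨m, hm⟩ := hy
    refine ⟨n + m, ?_⟩
    rw [show s ^ (n + m) * (x * y) = (s ^ n * x) * (s ^ m * y) by ring]
    exact mul_mem hn hm

theorem exists_forall_pow_mul_mem (hV : V.FG)
    (h : ∀ x ∈ V, ∃ d ∈ U, d ≠ 0 ∧ d * x ∈ U) :
    ∃ f ∈ U, f ≠ 0 ∧ ∀ x ∈ V, ∃ n : ℕ, f ^ n * x ∈ U := by
  classical
  obtain ⟨T, rfl⟩ := hV
  choose! d hdU hd0 hd using fun t (ht : t ∈ (T : Set K)) => h t (Algebra.subset_adjoin ht)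
  refine ⟨∏ t ∈ T, d t, prod_mem hdU, Finset.prod_ne_zero_iff.2 hd0, fun x hx =>
    exists_pow_mul_mem_of_mem_adjoin (prod_mem hdU) (fun t ht => ⟨1, ?_⟩) hx⟩
  rw [pow_one, ← Finset.prod_erase_mul _ _ ht, mul_assoc]
  exact mul_mem (prod_mem fun t ht => hdU t (Finset.mem_of_mem_erase ht)) (hd t ht)

theorem exists_inv_mem_of_adjoin {f f' : K} (hf : f ∈ U) (hf0 : f ≠ 0) (hf' : f' ∈ V)
    (hf'0 : f' ≠ 0) (hV : ∀ x ∈ V, ∃ n : ℕ, f ^ n * x ∈ U) {W : Subalgebra k K}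
    (hW : W = Algebra.adjoin k (U ∪ V ∪ {f⁻¹, f'⁻¹})) :
    ∃ s ∈ U, s⁻¹ ∈ W ∧ s ≠ 0 ∧ ∀ x ∈ W, ∃ n : ℕ, s ^ n * x ∈ U := by
  obtain ⟨n, hn⟩ := hV f' hf'
  -- The power `f ^ n` brings `f'` into `U`, and the extra factor `f` makes this one element
  -- divisible by `f` even when `n = 0`; inverting it inverts both `f` and `f'`.
  have hs : f * (f ^ n * f') ∈ U := mul_mem hf hn
  have h1 : f⁻¹ ∈ W := hW ▸ Algebra.subset_adjoin (by simp)
  have h2 : f'⁻¹ ∈ W := hW ▸ Algebra.subset_adjoin (by simp)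
  refine ⟨f * (f ^ n * f'), hs, ?_, by positivity, fun x hx => ?_⟩
  · rw [mul_inv, mul_inv, ← inv_pow]
    exact mul_mem h1 (mul_mem (pow_mem h1 n) h2)
  · rw [hW] at hx
    refine exists_pow_mul_mem_of_mem_adjoin hs ?_ hx
    rintro t ((ht | ht) | rfl | rfl)
    · exact ⟨0, by simpa using ht⟩
    · obtain ⟨m, hm⟩ := hV t ht
      refine ⟨m, ?_⟩
      rw [mul_pow, mul_right_comm]
      exact mul_mem hm (pow_mem hn m)
    · refine ⟨1, ?_⟩
      rw [pow_one, mul_comm, inv_mul_cancel_left₀ hf0]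
      exact hn
    · refine ⟨1, ?_⟩
      rw [pow_one, ← mul_assoc, mul_inv_cancel_right₀ hf'0]
      exact mul_mem hf (pow_mem hf n)

/-- Two finitely generated subalgebras with the same fractions have a common localization. -/
theorem exists_common_localization (hU : U.FG) (hV : V.FG)
    (hUV : ∀ x ∈ V, ∃ d ∈ U, d ≠ 0 ∧ d * x ∈ U) (hVU : ∀ x ∈ U, ∃ d ∈ V, d ≠ 0 ∧ d * x ∈ V) :
    ∃ W : Subalgebra k K, W.FG ∧ U ≤ W ∧ V ≤ W ∧
      (∃ s ∈ U, s⁻¹ ∈ W ∧ s ≠ 0 ∧ ∀ x ∈ W, ∃ n : ℕ, s ^ n * x ∈ U) ∧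
      (∃ s ∈ V, s⁻¹ ∈ W ∧ s ≠ 0 ∧ ∀ x ∈ W, ∃ n : ℕ, s ^ n * x ∈ V) := by
  classical
  obtain ⟨f, hf, hf0, hfV⟩ := exists_forall_pow_mul_mem hV hUV
  obtain ⟨f', hf', hf'0, hfU⟩ := exists_forall_pow_mul_mem hU hVU
  refine ⟨Algebra.adjoin k (U ∪ V ∪ {f⁻¹, f'⁻¹}), ?_,
    fun x hx => Algebra.subset_adjoin (by simp_all),
    fun x hx => Algebra.subset_adjoin (by simp_all),
    exists_inv_mem_of_adjoin hf hf0 hf' hf'0 hfV rfl,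
    exists_inv_mem_of_adjoin hf' hf'0 hf hf0 hfU ?_⟩
  · rw [Algebra.adjoin_union, Algebra.adjoin_union, Algebra.adjoin_eq, Algebra.adjoin_eq]
    exact (hU.sup hV).sup ⟨{f⁻¹, f'⁻¹}, by simp⟩
  · rw [Set.union_comm (U : Set K), Set.pair_comm]

end Subalgebras

end SpreadingOut

/-! ### Localization and base change -/

section BaseChange

theorem exists_isLocalization_baseChange {k B A W κ : Type*} [Field k] [CommRing B] [CommRing A]
    [CommRing W] [Field κ] [Algebra k B] [Algebra k A] [Algebra k κ] [Algebra B κ]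
    [IsScalarTower k B κ] [Algebra B W] [Algebra (B ⊗[k] A) W] [IsScalarTower B (B ⊗[k] A) W]
    (s : B ⊗[k] A) [IsLocalization.Away s W] :
    ∃ (_ : Algebra (A ⊗[k] κ) (κ ⊗[B] W)) (t : A ⊗[k] κ), IsLocalization.Away t (κ ⊗[B] W) ∧
      algebraMap κ (κ ⊗[B] W) = (algebraMap (A ⊗[k] κ) (κ ⊗[B] W)).comp
        (Algebra.TensorProduct.includeRight (R := k) (A := A) (B := κ)).toRingHom := by
  let e : κ ⊗[B] (B ⊗[k] A) ≃+* A ⊗[k] κ :=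
    ((Algebra.TensorProduct.cancelBaseChange k B κ κ A).toRingEquiv).trans
      (Algebra.TensorProduct.comm k κ A).toRingEquiv
  let j : κ ⊗[B] (B ⊗[k] A) →ₐ[κ] κ ⊗[B] W :=
    Algebra.TensorProduct.map (AlgHom.id κ κ) (IsScalarTower.toAlgHom B (B ⊗[k] A) W)
  let : Algebra (κ ⊗[B] (B ⊗[k] A)) (κ ⊗[B] W) := j.toAlgebra
  have h := IsLocalization.tensorProduct_tensorProduct_right B κ (Submonoid.powers s) W rfl
  rw [Submonoid.map_powers] at h
  have h2 := IsLocalization.isLocalization_of_base_ringEquiv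
    (Submonoid.powers (Algebra.TensorProduct.includeRight s : κ ⊗[B] (B ⊗[k] A))) (κ ⊗[B] W) e
  rw [Submonoid.map_powers] at h2
  refine ⟨_, _, h2, ?_⟩
  ext x
  change x ⊗ₜ 1 = j (e.symm (1 ⊗ₜ x))
  rw [show e.symm (1 ⊗ₜ x) = x ⊗ₜ 1 from e.symm_apply_eq.2 (by
    simp [e, Algebra.TensorProduct.one_def])]
  simp [j]

theorem isLocalizationAway_of_injective {U W K : Type*} [CommRing U] [CommRing W] [CommRing K]
    [Algebra U W] (ω : W →+* K) (hω : Function.Injective ω)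
    (hu : Function.Injective (algebraMap U W)) (s : U) (hs : ∃ w, ω (algebraMap U W s) * ω w = 1)
    (h : ∀ x : W, ∃ (n : ℕ) (z : U), ω (algebraMap U W s) ^ n * ω x = ω (algebraMap U W z)) :
    IsLocalization.Away s W := by
  refine ⟨⟨?_, fun x => ?_, fun {x y} hxy => ⟨1, by rw [hu hxy]⟩⟩⟩
  · rintro ⟨_, n, rfl⟩
    obtain ⟨w, hw⟩ := hs
    rw [map_pow]
    refine IsUnit.pow n (.of_mul_eq_one w (hω ?_))
    rw [map_mul, hw, map_one]
  · obtain ⟨n, z, hz⟩ := h x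
    refine ⟨(z, ⟨s ^ n, n, rfl⟩), hω ?_⟩
    rw [← hz, map_mul, map_pow, map_pow, mul_comm]

end BaseChange

/-! ### Spreading out and specialization to a finite extension -/

section SpreadingOut

variable {k : Type u} {L : Type v} {K : Type w} [Field k] [Field L] [Field K] [Algebra k L]
  [Algebra k K] [Algebra L K] [IsScalarTower k L K]

theorem exists_finset_mem_adjoin_sup {A : Type*} [CommRing A] [Algebra k A] (a : A →ₐ[k] K)
    (z : L ⊗[k] A) : ∃ S : Finset L, ∀ B : Subalgebra k L, (S : Set L) ⊆ B →
      Algebra.TensorProduct.productMap (IsScalarTower.toAlgHom k L K) a z ∈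
        (Algebra.TensorProduct.productMap ((IsScalarTower.toAlgHom k L K).comp B.val) a).range := by
  classical
  induction z using TensorProduct.induction_on with
  | zero => exact ⟨∅, fun B _ => by rw [map_zero]; exact zero_mem _⟩
  | tmul l x =>
    exact ⟨{l}, fun B hB => ⟨(⟨l, hB (by simp)⟩ : B) ⊗ₜ x, by simp⟩⟩
  | add x y hx hy =>
    obtain ⟨S, hS⟩ := hx
    obtain ⟨T, hT⟩ := hy
    refine ⟨S ∪ T, fun B hB => ?_⟩
    rw [Finset.coe_union, Set.union_subset_iff] at hB
    rw [map_add]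
    exact add_mem (hS B hB.1) (hT B hB.2)

/-- Finitely many elements of the field of fractions of `L ⊗ A` are fractions of elements
of `B ⊗ A` for some finitely generated `B`. -/
theorem exists_finset_forall_mul_mem {A : Type*} [CommRing A] [Algebra k A] (a : A →ₐ[k] K)
    (h : ∀ x : K, ∃ c d, Algebra.TensorProduct.productMap (IsScalarTower.toAlgHom k L K) a d ≠ 0 ∧
      Algebra.TensorProduct.productMap (IsScalarTower.toAlgHom k L K) a d * x =
        Algebra.TensorProduct.productMap (IsScalarTower.toAlgHom k L K) a c) (T : Finset K) :
    ∃ S : Finset L, ∀ B : Subalgebra k L, (S : Set L) ⊆ B → ∀ x ∈ T,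
      ∃ d ∈ (Algebra.TensorProduct.productMap ((IsScalarTower.toAlgHom k L K).comp B.val) a).range,
        d ≠ 0 ∧ d * x ∈
          (Algebra.TensorProduct.productMap ((IsScalarTower.toAlgHom k L K).comp B.val) a).range := by
  classical
  choose c d hd hc using h
  choose S hS using exists_finset_mem_adjoin_sup (L := L) a
  refine ⟨T.biUnion fun x => S (c x) ∪ S (d x), fun B hB x hx => ?_⟩
  have hsub : (S (c x) ∪ S (d x) : Finset L) ⊆ T.biUnion fun x => S (c x) ∪ S (d x) :=
    Finset.subset_biUnion_of_mem (fun x => S (c x) ∪ S (d x)) hx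
  refine ⟨_, hS (d x) B fun l hl => hB (hsub (Finset.mem_union_right _ hl)), hd x, ?_⟩
  rw [hc]
  exact hS (c x) B fun l hl => hB (hsub (Finset.mem_union_left _ hl))

theorem forall_mul_mem_of_mem_adjoin {U : Subalgebra k K} {T : Set K}
    (hT : ∀ t ∈ T, ∃ d ∈ U, d ≠ 0 ∧ d * t ∈ U) {x : K} (hx : x ∈ Algebra.adjoin k T) :
    ∃ d ∈ U, d ≠ 0 ∧ d * x ∈ U := by
  induction hx using Algebra.adjoin_induction with
  | mem x hx => exact hT x hx
  | algebraMap r => exact ⟨1, one_mem _, one_ne_zero, by simp⟩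
  | add x y _ _ hx hy =>
    obtain ⟨d, hd, hd0, hdx⟩ := hx
    obtain ⟨e, he, he0, hey⟩ := hy
    refine ⟨d * e, mul_mem hd he, mul_ne_zero hd0 he0, ?_⟩
    rw [show d * e * (x + y) = e * (d * x) + d * (e * y) by ring]
    exact add_mem (mul_mem he hdx) (mul_mem hd hey)
  | mul x y _ _ hx hy =>
    obtain ⟨d, hd, hd0, hdx⟩ := hx
    obtain ⟨e, he, he0, hey⟩ := hy
    refine ⟨d * e, mul_mem hd he, mul_ne_zero hd0 he0, ?_⟩
    rw [show d * e * (x * y) = (d * x) * (e * y) by ring]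
    exact mul_mem hdx hey

/-- Two finitely generated algebras whose tensor products with `L` have the same field of
fractions become isomorphic over a finite extension of `k`, after localization. -/
theorem exists_finite_common_localization {A A' : Type u} [CommRing A] [CommRing A']
    [Algebra k A] [Algebra k A'] [Algebra.FiniteType k A] [Algebra.FiniteType k A']
    (a : A →ₐ[k] K) (a' : A' →ₐ[k] K)
    (ha : Function.Injective
      (Algebra.TensorProduct.productMap (IsScalarTower.toAlgHom k L K) a))
    (ha' : Function.Injective
      (Algebra.TensorProduct.productMap (IsScalarTower.toAlgHom k L K) a'))
    (h : ∀ x : K, ∃ c d, Algebra.TensorProduct.productMap (IsScalarTower.toAlgHom k L K) a d ≠ 0 ∧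
      Algebra.TensorProduct.productMap (IsScalarTower.toAlgHom k L K) a d * x =
        Algebra.TensorProduct.productMap (IsScalarTower.toAlgHom k L K) a c)
    (h' : ∀ x : K, ∃ c d, Algebra.TensorProduct.productMap (IsScalarTower.toAlgHom k L K) a' d ≠ 0 ∧
      Algebra.TensorProduct.productMap (IsScalarTower.toAlgHom k L K) a' d * x =
        Algebra.TensorProduct.productMap (IsScalarTower.toAlgHom k L K) a' c) :
    ∃ (κ : Type u) (_ : Field κ) (_ : Algebra k κ) (R : Type u) (_ : CommRing R) (_ : Algebra κ R)
      (_ : Algebra (A ⊗[k] κ) R) (_ : Algebra (A' ⊗[k] κ) R) (t : A ⊗[k] κ) (t' : A' ⊗[k] κ),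
      FiniteDimensional k κ ∧ Nontrivial R ∧ IsLocalization.Away t R ∧ IsLocalization.Away t' R ∧
      algebraMap κ R = (algebraMap (A ⊗[k] κ) R).comp
        (Algebra.TensorProduct.includeRight (R := k) (A := A) (B := κ)).toRingHom ∧
      algebraMap κ R = (algebraMap (A' ⊗[k] κ) R).comp
        (Algebra.TensorProduct.includeRight (R := k) (A := A') (B := κ)).toRingHom := by
  classical
  obtain ⟨T, hT⟩ := (Algebra.FiniteType.out : (⊤ : Subalgebra k A).FG)
  obtain ⟨T', hT'⟩ := (Algebra.FiniteType.out : (⊤ : Subalgebra k A').FG)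
  obtain ⟨S, hS⟩ := exists_finset_forall_mul_mem (L := L) a h (T'.image a')
  obtain ⟨S', hS'⟩ := exists_finset_forall_mul_mem (L := L) a' h' (T.image a)
  -- The algebra `B` contains all elements of `L` needed to write the generators of each of `A`,
  -- `A'` as fractions over the other.
  obtain ⟨B, _, _, _, ⟨eB⟩⟩ := exists_algEquiv_of_fg (Algebra.adjoin k ((S ∪ S' : Finset L) : Set L))
    ⟨_, rfl⟩
  set C := Algebra.adjoin k ((S ∪ S' : Finset L) : Set L) with hC
  have hSC : (S : Set L) ⊆ C := fun x hx => Algebra.subset_adjoin (by simp_all)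
  have hSC' : (S' : Set L) ⊆ C := fun x hx => Algebra.subset_adjoin (by simp_all)
  have hfac : ∀ (D : Type u) [CommRing D] [Algebra k D] [Algebra.FiniteType k D] (d : D →ₐ[k] K),
      (Function.Injective (Algebra.TensorProduct.productMap (IsScalarTower.toAlgHom k L K) d)) →
      ∃ β : B ⊗[k] D →ₐ[k] K, Function.Injective β ∧ β.range.FG ∧
        β.range = (Algebra.TensorProduct.productMap ((IsScalarTower.toAlgHom k L K).comp
          C.val) d).range ∧ ∀ x, β (x ⊗ₜ 1) = algebraMap L K (eB x) := by
    intro D _ _ _ d hd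
    have hinj : Function.Injective
        (Algebra.TensorProduct.map (C.val.comp eB.toAlgHom) (AlgHom.id k D)) :=
      Module.Flat.rTensor_preserves_injective_linearMap
        (C.val.comp eB.toAlgHom).toLinearMap (Subtype.val_injective.comp eB.injective)
    refine ⟨(Algebra.TensorProduct.productMap (IsScalarTower.toAlgHom k L K) d).comp
      (Algebra.TensorProduct.map (C.val.comp eB.toAlgHom) (AlgHom.id k D)),
      hd.comp hinj, ?_, ?_, fun x => by simp⟩
    · have : Algebra.FiniteType k (B ⊗[k] D) := .trans (S := B) inferInstance inferInstance
      rw [← Algebra.map_top]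
      exact Algebra.FiniteType.out.map _
    · have : (Algebra.TensorProduct.productMap (IsScalarTower.toAlgHom k L K) d).comp
          (Algebra.TensorProduct.map (C.val.comp eB.toAlgHom) (AlgHom.id k D)) =
          Algebra.TensorProduct.productMap
            (((IsScalarTower.toAlgHom k L K).comp C.val).comp eB.toAlgHom) d := by
        ext <;> simp
      rw [this, Algebra.TensorProduct.productMap_range, Algebra.TensorProduct.productMap_range,
        AlgHom.range_comp,
        (AlgHom.range_eq_top eB.toAlgHom).2 eB.surjective, Algebra.map_top]
  obtain ⟨β, hβ, hβfg, hβr, hβB⟩ := hfac A a ha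
  obtain ⟨β', hβ', hβfg', hβr', hβB'⟩ := hfac A' a' ha'
  have hfrac : ∀ (D D' : Type u) [CommRing D] [CommRing D'] [Algebra k D] [Algebra k D']
      (d : D →ₐ[k] K) (d' : D' →ₐ[k] K) (G : Finset D') (_ : Algebra.adjoin k (G : Set D') = ⊤)
      (_ : ∀ x ∈ G.image d', ∃ f ∈ (Algebra.TensorProduct.productMap
        ((IsScalarTower.toAlgHom k L K).comp C.val) d).range, f ≠ 0 ∧ f * x ∈
          (Algebra.TensorProduct.productMap ((IsScalarTower.toAlgHom k L K).comp C.val) d).range),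
      ∀ x ∈ (Algebra.TensorProduct.productMap
        ((IsScalarTower.toAlgHom k L K).comp C.val) d').range, ∃ f ∈
        (Algebra.TensorProduct.productMap ((IsScalarTower.toAlgHom k L K).comp C.val) d).range,
        f ≠ 0 ∧ f * x ∈
          (Algebra.TensorProduct.productMap ((IsScalarTower.toAlgHom k L K).comp C.val) d).range := by
    intro D D' _ _ _ _ d d' G hG hGf x hx
    refine forall_mul_mem_of_mem_adjoin (T := ((Algebra.TensorProduct.productMap
        ((IsScalarTower.toAlgHom k L K).comp C.val) d).range : Set K) ∪ d' '' G) ?_ ?_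
    · rintro t (ht | ht)
      · exact ⟨1, one_mem _, one_ne_zero, by rwa [one_mul]⟩
      · exact hGf t (by simpa using ht)
    · rw [Algebra.adjoin_union, Algebra.adjoin_eq, ← AlgHom.map_adjoin, hG, Algebra.map_top]
      rw [Algebra.TensorProduct.productMap_range] at hx ⊢
      exact (sup_le_sup_right le_sup_left _ : _ ⊔ d'.range ≤ _ ⊔ _ ⊔ d'.range) hx
  obtain ⟨W, hW, hUW, hVW, ⟨s, hs, hsW, hs0, hsl⟩, ⟨s', hs', hsW', hs0', hsl'⟩⟩ :=
    exists_common_localization hβfg hβfg'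
      (hβr ▸ hβr' ▸ hfrac A A' a a' T' hT' (hS C hSC))
      (hβr ▸ hβr' ▸ hfrac A' A a' a T hT (hS' C hSC'))
  obtain ⟨W₀, _, _, _, ⟨eW⟩⟩ := exists_algEquiv_of_fg W hW
  let ω : W₀ →ₐ[k] K := W.val.comp eW.toAlgHom
  have hω : Function.Injective ω := Subtype.val_injective.comp eW.injective
  have hωW : ∀ x, ω x ∈ W := fun x => (eW x).2
  have hωs : ∀ x ∈ W, ∃ y, ω y = x := fun x hx => ⟨eW.symm ⟨x, hx⟩, by simp [ω]⟩
  let γ : B ⊗[k] A →ₐ[k] W₀ := eW.symm.toAlgHom.comp (β.codRestrict W fun x => hUW ⟨x, rfl⟩)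
  let γ' : B ⊗[k] A' →ₐ[k] W₀ := eW.symm.toAlgHom.comp (β'.codRestrict W fun x => hVW ⟨x, rfl⟩)
  have hγ : ∀ x, ω (γ x) = β x := fun x => by simp [ω, γ]
  have hγ' : ∀ x, ω (γ' x) = β' x := fun x => by simp [ω, γ']
  let : Algebra (B ⊗[k] A) W₀ := γ.toAlgebra
  let : Algebra (B ⊗[k] A') W₀ := γ'.toAlgebra
  let : Algebra B W₀ := (γ.comp Algebra.TensorProduct.includeLeft).toAlgebra
  have : IsScalarTower B (B ⊗[k] A) W₀ := .of_algebraMap_eq' rfl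
  have : IsScalarTower B (B ⊗[k] A') W₀ := .of_algebraMap_eq fun x => hω (by
    change ω (γ (x ⊗ₜ 1)) = ω (γ' (x ⊗ₜ 1))
    rw [hγ, hγ', hβB, hβB'])
  obtain ⟨s, rfl⟩ := hs
  obtain ⟨s', rfl⟩ := hs'
  have : IsLocalization.Away s W₀ := by
    refine isLocalizationAway_of_injective ω.toRingHom hω
      (.of_comp (f := ω) (by convert hβ using 1; ext x; exact hγ x)) s ?_ fun x => ?_
    · obtain ⟨w, hw⟩ := hωs _ hsW
      refine ⟨w, ?_⟩
      change ω (γ s) * ω w = 1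
      rw [hγ, hw]
      exact mul_inv_cancel₀ hs0
    · obtain ⟨n, z, hz⟩ := hsl (ω x) (hωW x)
      refine ⟨n, z, ?_⟩
      change ω (γ s) ^ n * ω x = ω (γ z)
      rw [hγ, hγ]
      exact hz.symm
  have : IsLocalization.Away s' W₀ := by
    refine isLocalizationAway_of_injective ω.toRingHom hω
      (.of_comp (f := ω) (by convert hβ' using 1; ext x; exact hγ' x)) s' ?_ fun x => ?_
    · obtain ⟨w, hw⟩ := hωs _ hsW'
      refine ⟨w, ?_⟩
      change ω (γ' s') * ω w = 1
      rw [hγ', hw]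
      exact mul_inv_cancel₀ hs0'
    · obtain ⟨n, z, hz⟩ := hsl' (ω x) (hωW x)
      refine ⟨n, z, ?_⟩
      change ω (γ' s') ^ n * ω x = ω (γ' z)
      rw [hγ', hγ']
      exact hz.symm
  have : Nontrivial W₀ := ω.toRingHom.domain_nontrivial
  -- Any closed point of the common localization will do, hence `a := 1`. Taking it on `W₀` rather
  -- than on `B` ensures that the fibre over it is nonempty.
  obtain ⟨κ, _, _, φ, hκ, -⟩ := exists_algHom_finite_ne_zero (k := k) (D := W₀) (a := 1)
    fun ⟨n, hn⟩ => one_ne_zero ((one_pow n).symm.trans hn)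
  let : Algebra B κ := (φ.comp (γ.comp Algebra.TensorProduct.includeLeft)).toAlgebra
  have : IsScalarTower k B κ := .of_algebraMap_eq fun x =>
    (AlgHom.commutes (φ.comp (γ.comp Algebra.TensorProduct.includeLeft)) x).symm
  let φB : W₀ →ₐ[B] κ := { φ with commutes' := fun _ => rfl }
  -- The chosen point is a `B`-homomorphism `W₀ → κ`, so the fibre maps to `κ`.
  have hR : Nontrivial (κ ⊗[B] W₀) :=
    (Algebra.TensorProduct.productMap (AlgHom.id B κ) φB).toRingHom.domain_nontrivial
  obtain ⟨i1, t, ht, hc⟩ := exists_isLocalization_baseChange (κ := κ) (W := W₀) s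
  obtain ⟨i2, t', ht', hc'⟩ := exists_isLocalization_baseChange (κ := κ) (W := W₀) s'
  exact ⟨κ, _, _, κ ⊗[B] W₀, _, _, i1, i2, t, t', hκ, hR, ht, ht', hc, hc'⟩

end SpreadingOut

theorem SupportSystem.isRegularExtension {k : Type*} {L : Type v} {Ψ : Type*} [Field k] [Field L]
    [Algebra k L] [Infinite Ψ] {ρ : Equiv.Perm Ψ →* (L ≃ₐ[k] L)}
    {S : Set Ψ → IntermediateField k L} (hS : SupportSystem ρ S) : IsRegularExtension k L :=
  ⟨fun p _ _ _ hl => hS.linearIndependent_pow' p hl, fun _ hx => hS.mem_bot_of_isAlgebraic hx⟩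

/-! ### Fields of fractions of `L ⊗ N` inside `K` -/

section ProductMap

variable {k L K : Type*} [Field k] [Field L] [Field K] [Algebra k L]
  [Algebra k K] [Algebra L K] [IsScalarTower k L K]

theorem productMap_comp_injective {M N : Type*} [CommRing M] [CommRing N] [Algebra k M]
    [Algebra k N] {f : N →ₐ[k] K} (hf : Function.Injective
      (Algebra.TensorProduct.productMap (IsScalarTower.toAlgHom k L K) f)) {g : M →ₐ[k] N}
    (hg : Function.Injective g) : Function.Injective
      (Algebra.TensorProduct.productMap (IsScalarTower.toAlgHom k L K) (f.comp g)) := by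
  have : Algebra.TensorProduct.productMap (IsScalarTower.toAlgHom k L K) (f.comp g) =
      (Algebra.TensorProduct.productMap (IsScalarTower.toAlgHom k L K) f).comp
        (Algebra.TensorProduct.map (AlgHom.id k L) g) := by
    ext <;> simp
  rw [this, AlgHom.coe_comp]
  exact hf.comp (Module.Flat.lTensor_preserves_injective_linearMap g.toLinearMap hg)

theorem exists_productMap_mul_eq {N : Type*} [CommRing N] [Algebra k N] {f : N →ₐ[k] K}
    (htop : IntermediateField.adjoin L (Set.range f) = ⊤) (x : K) :
    ∃ c d, Algebra.TensorProduct.productMap (IsScalarTower.toAlgHom k L K) f d ≠ 0 ∧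
      Algebra.TensorProduct.productMap (IsScalarTower.toAlgHom k L K) f d * x =
        Algebra.TensorProduct.productMap (IsScalarTower.toAlgHom k L K) f c := by
  have hx : x ∈ IntermediateField.adjoin L (Set.range f) := htop ▸ IntermediateField.mem_top
  have hrange : ∀ y ∈ Algebra.adjoin L (Set.range f),
      ∃ c, Algebra.TensorProduct.productMap (IsScalarTower.toAlgHom k L K) f c = y := by
    intro y hy
    induction hy using Algebra.adjoin_induction with
    | mem y hy =>
      obtain ⟨n, rfl⟩ := hy
      exact ⟨1 ⊗ₜ n, by simp⟩
    | algebraMap l => exact ⟨l ⊗ₜ 1, by simp⟩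
    | add y z _ _ hy hz =>
      obtain ⟨c, rfl⟩ := hy
      obtain ⟨d, rfl⟩ := hz
      exact ⟨c + d, map_add _ _ _⟩
    | mul y z _ _ hy hz =>
      obtain ⟨c, rfl⟩ := hy
      obtain ⟨d, rfl⟩ := hz
      exact ⟨c * d, map_mul _ _ _⟩
  obtain ⟨r, hr, s, hs, rfl⟩ := IntermediateField.mem_adjoin_iff_div.1 hx
  obtain ⟨c, rfl⟩ := hrange r hr
  obtain ⟨d, rfl⟩ := hrange s hs
  by_cases hd : Algebra.TensorProduct.productMap (IsScalarTower.toAlgHom k L K) f d = 0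
  · exact ⟨0, 1, by simp, by simp [hd]⟩
  · exact ⟨c, d, hd, mul_div_cancel₀ _ hd⟩

theorem isFractionRing_productMap {N : Type*} [CommRing N] [Algebra k N] {f : N →ₐ[k] K}
    (hf : Function.Injective
      (Algebra.TensorProduct.productMap (IsScalarTower.toAlgHom k L K) f))
    (htop : IntermediateField.adjoin L (Set.range f) = ⊤) :
    @IsFractionRing (L ⊗[k] N) _ K _
      (Algebra.TensorProduct.productMap (IsScalarTower.toAlgHom k L K) f).toAlgebra := by
  let : Algebra (L ⊗[k] N) K :=
    (Algebra.TensorProduct.productMap (IsScalarTower.toAlgHom k L K) f).toAlgebra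
  have : FaithfulSMul (L ⊗[k] N) K := (faithfulSMul_iff_algebraMap_injective _ _).2 hf
  refine IsFractionRing.of_field _ _ fun x => ?_
  obtain ⟨c, d, hd, h⟩ := exists_productMap_mul_eq htop x
  exact ⟨c, d, (eq_div_iff hd).2 ((mul_comm _ _).trans h)⟩

end ProductMap

/-! ### Descent of the variety -/

section Descent

variable {k : Type u} {L : Type v} {K : Type w} {Ψ : Type*} [Field k] [Field L] [Field K]
  [Algebra k L] [Algebra k K] [Algebra L K] [IsScalarTower k L K] [Infinite Ψ]

/-- Geometric irreducibility passes from `Y` to `k(Y)`, then to `L ⊗ k(Y)` by regularity of `L|k`,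
to its fraction field `K`, and finally to any subalgebra of `K`. -/
theorem isPrime_nilradical_tensorProduct_of_injective (hL : IsRegularExtension k L)
    (Y : AbsIrredVariety k) {y : Y.FunField →ₐ[k] K} (hy : Function.Injective
      (Algebra.TensorProduct.productMap (IsScalarTower.toAlgHom k L K) y))
    (htop : IntermediateField.adjoin L (Set.range y) = ⊤) {A : Type*} [CommRing A] [Algebra k A]
    (a : A →ₐ[k] K) (ha : Function.Injective a) (E : Type u) [Field E] [Algebra k E] :
    (nilradical (A ⊗[k] E)).IsPrime := by
  obtain ⟨D, _, _, _, _, i, _, _, _, _, hi⟩ := Y.exists_affine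
  have hgi : GeometricallyIrreducible (specMap k D) := by
    -- Surjectivity onto `Spec k` keeps every base change of the open subscheme nonempty.
    have : Surjective (i ≫ Y.str) := hi ▸ ⟨PrimeSpectrum.comap_surjective_of_faithfullyFlat⟩
    rw [← hi]
    infer_instance
  have h1 := geometricallyIrreducible_specMap_iff.1 hgi E
  have h2 : (nilradical (Y.FunField ⊗[k] E)).IsPrime :=
    isPrime_nilradical_fractionRing_tensorProduct h1
  have h3 : (nilradical (L ⊗[k] (Y.FunField ⊗[k] E))).IsPrime :=
    isPrime_nilradical_tensorProduct hL h2
  let e := Algebra.TensorProduct.assoc k k k L Y.FunField E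
  have h4 : (nilradical ((L ⊗[k] Y.FunField) ⊗[k] E)).IsPrime :=
    isPrime_nilradical_of_injective e.toRingHom e.injective h3
  let : Algebra (L ⊗[k] Y.FunField) K :=
    (Algebra.TensorProduct.productMap (IsScalarTower.toAlgHom k L K) y).toAlgebra
  have : IsScalarTower k (L ⊗[k] Y.FunField) K := .of_algebraMap_eq fun x =>
    ((Algebra.TensorProduct.productMap (IsScalarTower.toAlgHom k L K) y).commutes x).symm
  have : IsFractionRing (L ⊗[k] Y.FunField) K := isFractionRing_productMap hy htop
  have : IsDomain (L ⊗[k] Y.FunField) := isDomain_tensorProduct hL Y.FunField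
  have h5 : (nilradical (K ⊗[k] E)).IsPrime :=
    isPrime_nilradical_fractionRing_tensorProduct h4
  exact isPrime_nilradical_of_injective
    (Algebra.TensorProduct.map a (AlgHom.id k E)).toRingHom
    (Module.Flat.rTensor_preserves_injective_linearMap a.toLinearMap ha) h5

/-- A variety over `L` with a smooth semilinear action descends to the invariants. -/
theorem SupportSystem.exists_descent {ρ : Equiv.Perm Ψ →* (L ≃ₐ[k] L)}
    {S : Set Ψ → IntermediateField k L} (hS : SupportSystem ρ S) (Y : AbsIrredVariety k)
    {y : Y.FunField →ₐ[k] K} (hy : Function.Injective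
      (Algebra.TensorProduct.productMap (IsScalarTower.toAlgHom k L K) y))
    (htop : IntermediateField.adjoin L (Set.range y) = ⊤) {ρK : Equiv.Perm Ψ →* (K ≃ₐ[k] K)}
    (hsmooth : IsSmooth ρK) (hρ : ∀ g x, ρK g (algebraMap L K x) = algebraMap L K (ρ g x)) :
    ∃ (Y' : AbsIrredVariety k) (j : Y'.FunField ≃ₐ[k] invariants ρK),
      Function.Injective (Algebra.TensorProduct.productMap (IsScalarTower.toAlgHom k L K)
        ((invariants ρK).val.comp j.toAlgHom)) ∧
      IntermediateField.adjoin L (Set.range ((invariants ρK).val.comp j.toAlgHom)) = ⊤ ∧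
      ∃ (κ : Type u) (_ : Field κ) (_ : Algebra k κ), FiniteDimensional k κ ∧
        Scheme.BirationalOver (Y.baseChange κ) (Y'.baseChange κ) := by
  classical
  obtain ⟨A, _, _, _, _, i, _, _, _, _, hi⟩ := Y.exists_affine
  obtain ⟨T, hT⟩ := (Algebra.FiniteType.out : (⊤ : Subalgebra k A).FG)
  let a : A →ₐ[k] K := y.comp (IsScalarTower.toAlgHom k A Y.FunField)
  have ha : Function.Injective
      (Algebra.TensorProduct.productMap (IsScalarTower.toAlgHom k L K) a) :=
    productMap_comp_injective hy (IsFractionRing.injective A Y.FunField)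
  have hgen : IntermediateField.adjoin L (a '' T) = ⊤ := by
    rw [eq_top_iff, ← htop, IntermediateField.adjoin_le_iff]
    have hA : ∀ x, a x ∈ IntermediateField.adjoin L (a '' T) := by
      intro x
      have hx : x ∈ Algebra.adjoin k (T : Set A) := hT ▸ Algebra.mem_top
      induction hx using Algebra.adjoin_induction with
      | mem x hx => exact IntermediateField.subset_adjoin _ _ ⟨x, hx, rfl⟩
      | algebraMap c =>
        rw [AlgHom.commutes, IsScalarTower.algebraMap_apply k L K]
        exact algebraMap_mem _ _
      | add x y _ _ hx hy => rw [map_add]; exact add_mem hx hy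
      | mul x y _ _ hx hy => rw [map_mul]; exact mul_mem hx hy
    rintro _ ⟨z, rfl⟩
    obtain ⟨c, d, -, rfl⟩ := IsFractionRing.div_surjective (A := A) z
    rw [map_div₀]
    exact div_mem (hA c) (hA d)
  choose J hJ using hsmooth
  -- Smoothness is applied to the finitely many generators only; one finite set serves them all.
  have hfix : a '' T ⊆ fixedBy ρK ((T.biUnion fun t => J (a t) : Finset Ψ) : Set Ψ) := by
    rintro _ ⟨t, ht, rfl⟩ g hg
    exact hJ (a t) g fun i hi => hg i (Finset.mem_coe.2 (Finset.mem_biUnion.2 ⟨t, ht, hi⟩))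
  have hfin := Finset.finite_toSet (T.biUnion fun t => J (a t))
  have htop0 := hS.adjoin_fixedBy_empty_eq_top hρ hfin hfix hgen
  have hinj0 := hS.productMap_fixedBy_empty_injective (ρK := ρK) hρ
  obtain ⟨T₀, hT₀⟩ := hS.exists_finset_adjoin_eq_fixedBy_empty hρ hfin
    ((Finset.finite_toSet T).image a) hfix hgen
  -- The coordinate ring of `Y'` is generated by field generators of the invariants, so its fraction
  -- field is the whole fixed field.
  obtain ⟨A', _, _, _, ⟨e⟩⟩ := exists_algEquiv_of_fg (Algebra.adjoin k (T₀ : Set K)) ⟨T₀, rfl⟩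
  let a' : A' →ₐ[k] K := (Algebra.adjoin k (T₀ : Set K)).val.comp e.toAlgHom
  have ha' : Function.Injective a' := Subtype.val_injective.comp e.injective
  have hra' : a'.range = Algebra.adjoin k (T₀ : Set K) := by
    rw [AlgHom.range_comp, (AlgHom.range_eq_top e.toAlgHom).2 e.surjective, Algebra.map_top,
      Subalgebra.range_val]
  have : IsDomain A' := ha'.isDomain a'.toRingHom
  have hgeom : ∀ (E : Type u) [Field E] [Algebra k E], (nilradical (A' ⊗[k] E)).IsPrime :=
    fun E _ _ => isPrime_nilradical_tensorProduct_of_injective hS.isRegularExtension Y hy htop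
      a' ha' E
  let Y' := AbsIrredVariety.ofAlgebra A' hgeom
  obtain ⟨_, _, _⟩ := AbsIrredVariety.ofAlgebra_funField A' hgeom
  let j₀ : Y'.FunField →ₐ[k] K := IsFractionRing.liftAlgHom ha'
  have hj₀ : j₀.fieldRange = fixedBy ρK ∅ :=
    (IsFractionRing.liftAlgHom_fieldRange_eq_of_range_eq ha' hra').trans hT₀
  have hj₀a : ∀ x, j₀ (algebraMap A' Y'.FunField x) = a' x :=
    IsFractionRing.lift_algebraMap ha'
  let j₁ : Y'.FunField →ₐ[k] fixedBy ρK ∅ := j₀.codRestrict (fixedBy ρK ∅).toSubalgebra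
    fun x => (hj₀ ▸ ⟨x, rfl⟩ : j₀ x ∈ fixedBy ρK ∅)
  have hmem : ∀ x, j₀ x ∈ invariants ρK := fun x => mem_fixedBy_empty.1 (j₁ x).2
  let j : Y'.FunField ≃ₐ[k] invariants ρK := AlgEquiv.ofBijective (j₀.codRestrict _ hmem)
    ⟨fun x z h => j₀.injective (congrArg Subtype.val h), fun x => by
      have : (x : K) ∈ j₀.fieldRange := hj₀ ▸ mem_fixedBy_empty.2 x.2
      obtain ⟨z, hz⟩ := this
      exact ⟨z, Subtype.ext hz⟩⟩
  have hj : (invariants ρK).val.comp j.toAlgHom = j₀ := AlgHom.ext fun x => rfl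
  have hj₀inj : Function.Injective
      (Algebra.TensorProduct.productMap (IsScalarTower.toAlgHom k L K) j₀) :=
    productMap_comp_injective hinj0 (g := j₁) j₁.injective
  have hj₀top : IntermediateField.adjoin L (Set.range j₀) = ⊤ := by
    rw [← htop0, ← hj₀]
    rfl
  have hinj' : Function.Injective
      (Algebra.TensorProduct.productMap (IsScalarTower.toAlgHom k L K) a') := by
    have : a' = j₀.comp (IsScalarTower.toAlgHom k A' Y'.FunField) :=
      AlgHom.ext fun x => (hj₀a x).symm
    rw [this]
    exact productMap_comp_injective hj₀inj (IsFractionRing.injective A' Y'.FunField)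
  have htopa' : IntermediateField.adjoin L (Set.range a') = ⊤ := by
    rw [eq_top_iff, ← hj₀top, IntermediateField.adjoin_le_iff]
    rintro _ ⟨z, rfl⟩
    obtain ⟨c, d, -, rfl⟩ := IsFractionRing.div_surjective (A := A') z
    rw [map_div₀, hj₀a, hj₀a]
    exact div_mem (IntermediateField.subset_adjoin _ _ ⟨c, rfl⟩)
      (IntermediateField.subset_adjoin _ _ ⟨d, rfl⟩)
  have htopa : IntermediateField.adjoin L (Set.range a) = ⊤ :=
    eq_top_iff.2 (hgen ▸ IntermediateField.adjoin.mono _ _ _ (Set.image_subset_range _ _))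
  obtain ⟨κ, _, _, R, _, _, _, _, t, t', hκ, _, _, _, h, h'⟩ :=
    exists_finite_common_localization a a' ha hinj' (exists_productMap_mul_eq htopa)
      (exists_productMap_mul_eq htopa')
  let i' : Spec (.of A') ⟶ Y'.X := 𝟙 (Spec (.of A'))
  have : IsOpenImmersion i' := inferInstanceAs (IsOpenImmersion (𝟙 (Spec (.of A'))))
  refine ⟨Y', j, hj ▸ hj₀inj, hj ▸ hj₀top, κ, _, _, hκ, ?_⟩
  exact (Y.birationalOver_baseChange i hi κ t R h).symm.trans
    (Y'.birationalOver_baseChange i' (Category.id_comp _) κ t' R h')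

end Descent

/-! ### The field `F_Ψ(Y)` and the conclusion -/

section FunctionFields

variable {k : Type u} [Field k] (F : Type v) (Ψ : Type w) [Field F] [Algebra k F] [Infinite Ψ]
  [IsDomain (Cop k F Ψ)] (Y : AbsIrredVariety k)

attribute [local instance] FPow.field

theorem isDomain_FPow_tensorProduct : IsDomain (FPow k F Ψ ⊗[k] Y.FunField) :=
  isDomain_tensorProduct (FPow.supportSystem k F).isRegularExtension Y.FunField

theorem FPowFun.isField : IsField (FPowFun F Ψ Y) :=
  have := isDomain_FPow_tensorProduct F Ψ Y
  Field.toIsField (FractionRing (FPow k F Ψ ⊗[k] Y.FunField))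

/-- The field structure of `F_Ψ(Y)`. -/
abbrev FPowFun.field : Field (FPowFun F Ψ Y) :=
  (FPowFun.isField F Ψ Y).toField

attribute [local instance] FPowFun.field

/-- The descent is phrased for an embedding of `k(Y)` into a field over `L`; this matches it with
the defining localization map of `F_Ψ(Y)`. -/
theorem FPowFun.productMap_ofFun :
    Algebra.TensorProduct.productMap (IsScalarTower.toAlgHom k (FPow k F Ψ) (FPowFun F Ψ Y))
      (FPowFun.ofFun F Ψ Y) =
    IsScalarTower.toAlgHom k (FPow k F Ψ ⊗[k] Y.FunField) (FPowFun F Ψ Y) := by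
  refine Algebra.TensorProduct.ext' fun x z => ?_
  rw [Algebra.TensorProduct.productMap_apply_tmul, IsScalarTower.coe_toAlgHom',
    IsScalarTower.algebraMap_apply (FPow k F Ψ) (FPow k F Ψ ⊗[k] Y.FunField) (FPowFun F Ψ Y)]
  change algebraMap _ _ _ * algebraMap (FPow k F Ψ ⊗[k] Y.FunField) _ (1 ⊗ₜ z) =
    algebraMap (FPow k F Ψ ⊗[k] Y.FunField) _ (x ⊗ₜ z)
  rw [← map_mul]
  simp

theorem FPowFun.productMap_ofFun_injective : Function.Injective
    (Algebra.TensorProduct.productMap (IsScalarTower.toAlgHom k (FPow k F Ψ) (FPowFun F Ψ Y))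
      (FPowFun.ofFun F Ψ Y)) := by
  rw [FPowFun.productMap_ofFun]
  exact IsFractionRing.injective (FPow k F Ψ ⊗[k] Y.FunField) (FPowFun F Ψ Y)

theorem FPowFun.adjoin_ofFun_eq_top :
    IntermediateField.adjoin (FPow k F Ψ) (Set.range (FPowFun.ofFun F Ψ Y)) = ⊤ := by
  have := isDomain_FPow_tensorProduct F Ψ Y
  have key : ∀ z : FPow k F Ψ ⊗[k] Y.FunField, algebraMap _ (FPowFun F Ψ Y) z ∈
      IntermediateField.adjoin (FPow k F Ψ) (Set.range (FPowFun.ofFun F Ψ Y)) := by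
    intro z
    induction z using TensorProduct.induction_on with
    | zero => rw [map_zero]; exact zero_mem _
    | tmul x z =>
      have h := DFunLike.congr_fun (FPowFun.productMap_ofFun F Ψ Y) (x ⊗ₜ z)
      rw [Algebra.TensorProduct.productMap_apply_tmul] at h
      change _ = algebraMap _ _ _ at h
      rw [← h]
      exact mul_mem (algebraMap_mem _ x) (IntermediateField.subset_adjoin _ _ ⟨z, rfl⟩)
    | add x z hx hz => rw [map_add]; exact add_mem hx hz
  rw [eq_top_iff]
  intro x _
  obtain ⟨c, d, -, rfl⟩ := IsFractionRing.div_surjective (A := FPow k F Ψ ⊗[k] Y.FunField) x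
  exact div_mem (key c) (key d)

variable {F Ψ Y}

/-- An embedding of `k(Y')` in `F_Ψ(Y)` that is linearly disjoint from `F_Ψ` and generates
`F_Ψ(Y)` over `F_Ψ` identifies `F_Ψ(Y')` with `F_Ψ(Y)`. -/
theorem FPowFun.exists_algEquiv {Y' : AbsIrredVariety k} {f : Y'.FunField →ₐ[k] FPowFun F Ψ Y}
    (hf : Function.Injective (Algebra.TensorProduct.productMap
      (IsScalarTower.toAlgHom k (FPow k F Ψ) (FPowFun F Ψ Y)) f))
    (htop : IntermediateField.adjoin (FPow k F Ψ) (Set.range f) = ⊤) :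
    ∃ e : FPowFun F Ψ Y' ≃ₐ[FPow k F Ψ] FPowFun F Ψ Y,
      ∀ z, e (FPowFun.ofFun F Ψ Y' z) = f z := by
  let : Algebra (FPow k F Ψ ⊗[k] Y'.FunField) (FPowFun F Ψ Y) :=
    (Algebra.TensorProduct.productMap
      (IsScalarTower.toAlgHom k (FPow k F Ψ) (FPowFun F Ψ Y)) f).toAlgebra
  have : IsFractionRing (FPow k F Ψ ⊗[k] Y'.FunField) (FPowFun F Ψ Y) :=
    isFractionRing_productMap hf htop
  let e := IsLocalization.algEquiv (nonZeroDivisors (FPow k F Ψ ⊗[k] Y'.FunField))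
    (FPowFun F Ψ Y') (FPowFun F Ψ Y)
  have he : ∀ z, e (algebraMap _ _ z) = Algebra.TensorProduct.productMap
      (IsScalarTower.toAlgHom k (FPow k F Ψ) (FPowFun F Ψ Y)) f z := e.commutes
  refine ⟨AlgEquiv.ofRingEquiv (f := e.toRingEquiv) fun x => ?_, fun z => ?_⟩
  · rw [IsScalarTower.algebraMap_apply (FPow k F Ψ) (FPow k F Ψ ⊗[k] Y'.FunField) (FPowFun F Ψ Y')]
    exact (he _).trans (by simp)
  · exact (he (1 ⊗ₜ z)).trans (by simp)

end FunctionFields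

end Isotrivial

end

theorem mainTheorem11 {k : Type u} {F : Type v} {Ψ : Type w} [Field k] [Field F]
    [Algebra k F] [Infinite Ψ] (hkF : algebraicClosure k F = ⊥)
    [IsDomain (Isotrivial.Cop k F Ψ)] (Y : Isotrivial.AbsIrredVariety k)
    (ρ : Equiv.Perm Ψ →* (Isotrivial.FPowFun F Ψ Y ≃ₐ[k] Isotrivial.FPowFun F Ψ Y))
    (hsmooth : Isotrivial.IsSmooth ρ)
    (hext : ∀ (σ : Equiv.Perm Ψ) (x : Isotrivial.FPow k F Ψ),
      ρ σ (algebraMap (Isotrivial.FPow k F Ψ) (Isotrivial.FPowFun F Ψ Y) x) =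
        algebraMap (Isotrivial.FPow k F Ψ) (Isotrivial.FPowFun F Ψ Y)
          (Isotrivial.FPow.perm k F σ x)) :
    ∃ Y' : Isotrivial.AbsIrredVariety k,
      (∃ (j : Y'.FunField ≃ₐ[k] Isotrivial.invariants ρ)
        (e : Isotrivial.FPowFun F Ψ Y' ≃ₐ[Isotrivial.FPow k F Ψ] Isotrivial.FPowFun F Ψ Y),
        ∀ y : Y'.FunField, e (Isotrivial.FPowFun.ofFun F Ψ Y' y) = j y) ∧
      ∃ (k' : Type u) (_ : Field k') (_ : Algebra k k'), FiniteDimensional k k' ∧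
        Scheme.BirationalOver (Y.baseChange k') (Y'.baseChange k') := by
  let := Isotrivial.FPow.field k F Ψ
  let := Isotrivial.FPowFun.field F Ψ Y
  obtain ⟨Y', j, hinj, htop, hbir⟩ :=
    (Isotrivial.FPow.supportSystem k F).exists_descent Y
      (Isotrivial.FPowFun.productMap_ofFun_injective F Ψ Y)
      (Isotrivial.FPowFun.adjoin_ofFun_eq_top F Ψ Y) (ρK := ρ) hsmooth hext
  obtain ⟨e, he⟩ := Isotrivial.FPowFun.exists_algEquiv hinj htop
  exact ⟨Y', ⟨j, e, he⟩, hbir⟩
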